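/- **Proposition (Local form of submersions).** Orbifolds are effective and without boundary: an orbifold chart $(\widetilde U,H,\phi)$ consists of a connected open set $\widetilde U\subset\mathbb{R}^n$, a finite group $H$ acting smoothly and effectively on $\widetilde U$, and a continuous $H$-invariant map $\phi$ to the underlying space inducing a homeomorphism from $\widetilde U/H$ onto an open set $U$; it is a chart *around* $x$ if $\phi^{-1}(x)$ is a single point $\tilde x$, in which case $H$ is the local group $\Gamma_x$. A map $f:\mathcal{O}\to\mathcal{P}$ is smooth if it is a continuous map of the underlying spaces which at every point $x$ has a smooth local lift, that is, there are charts $(\widetilde U,\Gamma_x,\phi)$ around $x$ and $(\widetilde V,\Gamma_{f(x)},\psi)$ around $f(x)$, a homomorphism $\overline f_x:\Gamma_x\to\Gamma_{f(x)}$ and a smooth $\overline f_x$-equivariant map $\widetilde f_x:\widetilde U\to\widetilde V$ with $\psi\circ\widetilde f_x=f\circ\phi$. It is a submersion at $x$ if some such local lift has both $d(\widetilde f_x)_{\tilde x}$ and $\overline f_x$ surjective. Let $\mathcal{O}$ and $\mathcal{P}$ be smooth orbifolds (of dimensions $n$ and $m$), and let $f:\mathcal{O}\to\mathcal{P}$ be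 a smooth map that is a submersion at $x\in\mathcal{O}$. Then there are an orbifold $\mathcal{F}$, a chart $(\widetilde V,\Gamma_{f(x)},\phi)$ of $\mathcal{P}$ around $f(x)$, with image $V$, and an action of $\Gamma_{f(x)}$ on $\mathcal{F}$ by smooth orbifold maps, such that $f$ is equivalent, near $x$, to the projection $$(\mathcal{F}\times\widetilde V)/\!/\Gamma_{f(x)}\longrightarrow \widetilde V/\!/\Gamma_{f(x)},$$ where $\Gamma_{f(x)}$ acts diagonally on $\mathcal{F}\times\widetilde V$. That is, there are an open neighborhood $U$ of $x$ and an orbifold diffeomorphism $\Theta:\mathcal{O}|_U\to(\mathcal{F}\times\widetilde V)/\!/\Gamma_{f(x)}$ such that the map $\overline\phi:\widetilde V/\!/\Gamma_{f(x)}\to\mathcal{P}|_V$ induced by $\phi$ is an orbifold diffeomorphism and $f|_U=\overline\phi\circ\mathrm{pr}\circ\Theta$, with $\mathrm{pr}$ the projection above. -/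

import Mathlib

open Set Topology
open scoped ContDiff

/-- An orbifold chart `(Ũ, H, φ)` on the space `X`: `dom` is the connected open set `Ũ` of the
model space `E` (for an `n`-dimensional orbifold `E` is `ℝⁿ`), `grp` is the finite group `H`, `act`
its smooth effective action on `Ũ`, and `map` is the map `φ`.  Functions are total for convenience;
only their values on `dom` are meaningful.  The last five fields say that `φ` is a continuous
`H`-invariant map that induces a homeomorphism from `Ũ / H` onto an open subset of `X`. -/
structure OrbifoldChart (E : Type*) [NormedAddCommGroup E] [NormedSpace ℝ E]
    (X : Type*) [TopologicalSpace X] where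
  dom : Set E
  isOpen_dom : IsOpen dom
  isConnected_dom : IsConnected dom
  grp : Type
  [group : Group grp]
  [finite : Finite grp]
  act : grp → E → E
  act_mapsTo : ∀ h, MapsTo (act h) dom dom
  act_one : ∀ y ∈ dom, act 1 y = y
  act_mul : ∀ g h, ∀ y ∈ dom, act (g * h) y = act g (act h y)
  act_smooth : ∀ h, ContDiffOn ℝ ∞ (act h) dom
  act_effective : ∀ h, (∀ y ∈ dom, act h y = y) → h = 1
  map : E → X
  map_continuousOn : ContinuousOn map dom
  map_act : ∀ h, ∀ y ∈ dom, map (act h y) = map y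
  exists_act_eq : ∀ y ∈ dom, ∀ z ∈ dom, map y = map z → ∃ h, act h y = z
  map_isOpen : ∀ W ⊆ dom, IsOpen W → IsOpen (map '' W)

namespace OrbifoldChart

attribute [instance] OrbifoldChart.group OrbifoldChart.finite

section Basic

variable {E : Type*} [NormedAddCommGroup E] [NormedSpace ℝ E]
  {X : Type*} [TopologicalSpace X]

/-- The open subset `U = φ(Ũ)` of `X` covered by the chart. -/
def image (c : OrbifoldChart E X) : Set X := c.map '' c.dom

/-- The chart is a chart *around* `x`: exactly one point of `Ũ` lies over `x`.  That point is then
fixed by the whole chart group, so the chart group is the local group `Γ_x`. -/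
def IsAround (c : OrbifoldChart E X) (x : X) : Prop :=
  ∃! y, y ∈ c.dom ∧ c.map y = x

/-- The chart group acts on the open set `Ũ`. -/
instance (c : OrbifoldChart E X) : MulAction c.grp c.dom where
  smul h y := ⟨c.act h y, c.act_mapsTo h y.2⟩
  one_smul y := Subtype.ext (c.act_one y y.2)
  mul_smul g h y := Subtype.ext (c.act_mul g h y y.2)

/-- The map `Ũ / H → X` induced by `φ`. -/
def orbitMap (c : OrbifoldChart E X) : Quotient (MulAction.orbitRel c.grp c.dom) → X :=
  Quotient.lift (fun y : c.dom => c.map y) (by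
    rintro a b ⟨h, rfl⟩
    exact c.map_act h b b.2)

/-- `lam` is an embedding of the chart `c₁` in the chart `c₂`: a smooth embedding (an immersion that
is a homeomorphism onto its image) `Ũ₁ → Ũ₂` with `φ₂ ∘ lam = φ₁`. -/
structure IsChartEmbedding (c₁ c₂ : OrbifoldChart E X) (lam : E → E) : Prop where
  mapsTo : MapsTo lam c₁.dom c₂.dom
  smooth : ContDiffOn ℝ ∞ lam c₁.dom
  immersion : ∀ y ∈ c₁.dom, Function.Injective (fderiv ℝ lam y)
  isEmbedding : IsEmbedding (c₁.dom.domRestrict lam)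
  comm : ∀ y ∈ c₁.dom, c₂.map (lam y) = c₁.map y

/-- Local compatibility of two charts: every common point lies in the image of a third chart that
embeds in both. -/
def Compatible (c₁ c₂ : OrbifoldChart E X) : Prop :=
  ∀ x ∈ c₁.image ∩ c₂.image, ∃ c₃ : OrbifoldChart E X, x ∈ c₃.image ∧
    (∃ lam, IsChartEmbedding c₃ c₁ lam) ∧ (∃ lam, IsChartEmbedding c₃ c₂ lam)

lemma IsChartEmbedding.refl (c : OrbifoldChart E X) : IsChartEmbedding c c id where
  mapsTo := mapsTo_id _
  smooth := contDiffOn_id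
  immersion := fun y _ => by
    rw [fderiv_id]
    exact Function.injective_id
  isEmbedding := IsEmbedding.subtypeVal
  comm := fun _ _ => rfl

lemma Compatible.refl (c : OrbifoldChart E X) : Compatible c c :=
  fun _ hx => ⟨c, hx.1, ⟨id, .refl c⟩, ⟨id, .refl c⟩⟩

open Classical in
/-- A connected open set `W` of the model space, as a chart (with trivial group) on itself. -/
noncomputable def ofOpen (W : Set E) (hW : IsOpen W) (hc : IsConnected W) :
    OrbifoldChart E W where
  dom := W
  isOpen_dom := hW
  isConnected_dom := hc
  grp := Unit
  act := fun _ y => y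
  act_mapsTo := fun _ => mapsTo_id _
  act_one := fun _ _ => rfl
  act_mul := fun _ _ _ _ => rfl
  act_smooth := fun _ => contDiffOn_id
  act_effective := fun _ _ => rfl
  map := fun y => if h : y ∈ W then ⟨y, h⟩ else ⟨hc.nonempty.some, hc.nonempty.some_mem⟩
  map_continuousOn := by
    rw [continuousOn_iff_continuous_domRestrict]
    convert continuous_id (X := W) using 1
    funext y
    simp
  map_act := fun _ _ _ => rfl
  exists_act_eq := fun y hy z hz h => ⟨(), by simpa [hy, hz] using h⟩
  map_isOpen := fun V hV ho => by
    have : ((fun y => if h : y ∈ W then (⟨y, h⟩ : W)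
        else ⟨hc.nonempty.some, hc.nonempty.some_mem⟩) '' V) = Subtype.val ⁻¹' V := by
      ext ⟨w, hw⟩
      constructor
      · rintro ⟨v, hv, h⟩
        have hvW := hV hv
        simp only [hvW, dif_pos, Subtype.mk.injEq] at h
        simpa [h] using hv
      · intro h
        exact ⟨w, h, by simp [hw]⟩
    rw [this]
    exact ho.preimage continuous_subtype_val

end Basic

section Prod

variable {E : Type*} [NormedAddCommGroup E] [NormedSpace ℝ E]
  {E' : Type*} [NormedAddCommGroup E'] [NormedSpace ℝ E']
  {X : Type*} [TopologicalSpace X] {Y : Type*} [TopologicalSpace Y]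

/-- The product chart `(Ũ × Ṽ, H × K, φ × ψ)`. -/
def prod (c : OrbifoldChart E X) (d : OrbifoldChart E' Y) : OrbifoldChart (E × E') (X × Y) where
  dom := c.dom ×ˢ d.dom
  isOpen_dom := c.isOpen_dom.prod d.isOpen_dom
  isConnected_dom := c.isConnected_dom.prod d.isConnected_dom
  grp := c.grp × d.grp
  act := fun h => Prod.map (c.act h.1) (d.act h.2)
  act_mapsTo := fun h _ hy => ⟨c.act_mapsTo h.1 hy.1, d.act_mapsTo h.2 hy.2⟩
  act_one := fun y hy => Prod.ext (c.act_one _ hy.1) (d.act_one _ hy.2)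
  act_mul := fun g h y hy => Prod.ext (c.act_mul g.1 h.1 _ hy.1) (d.act_mul g.2 h.2 _ hy.2)
  act_smooth := fun h => (c.act_smooth h.1).prodMap (d.act_smooth h.2)
  act_effective := fun h hh => by
    obtain ⟨a, ha⟩ := c.isConnected_dom.nonempty
    obtain ⟨b, hb⟩ := d.isConnected_dom.nonempty
    exact Prod.ext
      (c.act_effective _ fun y hy => congrArg Prod.fst (hh (y, b) ⟨hy, hb⟩))
      (d.act_effective _ fun y hy => congrArg Prod.snd (hh (a, y) ⟨ha, hy⟩))
  map := Prod.map c.map d.map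
  map_continuousOn := c.map_continuousOn.prodMap d.map_continuousOn
  map_act := fun h y hy => Prod.ext (c.map_act h.1 _ hy.1) (d.map_act h.2 _ hy.2)
  exists_act_eq := fun y hy z hz h => by
    obtain ⟨g, hg⟩ := c.exists_act_eq _ hy.1 _ hz.1 (congrArg Prod.fst h)
    obtain ⟨k, hk⟩ := d.exists_act_eq _ hy.2 _ hz.2 (congrArg Prod.snd h)
    exact ⟨(g, k), Prod.ext hg hk⟩
  map_isOpen := fun W hW ho => by
    rw [isOpen_iff_mem_nhds]
    rintro _ ⟨⟨a, b⟩, hab, rfl⟩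
    obtain ⟨u, v, hu, hv, hau, hbv, huv⟩ := isOpen_prod_iff.1 ho a b hab
    have hu' : u ⊆ c.dom := fun y hy => (hW (huv (show (y, b) ∈ u ×ˢ v from ⟨hy, hbv⟩))).1
    have hv' : v ⊆ d.dom := fun y hy => (hW (huv (show (a, y) ∈ u ×ˢ v from ⟨hau, hy⟩))).2
    refine Filter.mem_of_superset
      (((c.map_isOpen u hu' hu).prod (d.map_isOpen v hv' hv)).mem_nhds
        ⟨mem_image_of_mem _ hau, mem_image_of_mem _ hbv⟩) ?_
    rintro ⟨p, q⟩ ⟨⟨y, hy, rfl⟩, ⟨z, hz, rfl⟩⟩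
    exact ⟨(y, z), huv ⟨hy, hz⟩, rfl⟩

lemma image_prod (c : OrbifoldChart E X) (d : OrbifoldChart E' Y) :
    (c.prod d).image = c.image ×ˢ d.image :=
  (prodMap_image_prod c.map d.map c.dom d.dom)

lemma IsChartEmbedding.prod {c₁ c₂ : OrbifoldChart E X} {d₁ d₂ : OrbifoldChart E' Y}
    {lam : E → E} {mu : E' → E'} (hl : IsChartEmbedding c₁ c₂ lam)
    (hm : IsChartEmbedding d₁ d₂ mu) :
    IsChartEmbedding (c₁.prod d₁) (c₂.prod d₂) (Prod.map lam mu) where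
  mapsTo := fun _ hy => ⟨hl.mapsTo hy.1, hm.mapsTo hy.2⟩
  smooth := hl.smooth.prodMap hm.smooth
  immersion := by
    rintro ⟨y, z⟩ ⟨hy, hz⟩
    have h1 := ((hl.smooth.contDiffAt (c₁.isOpen_dom.mem_nhds hy)).differentiableAt
      (by simp)).hasFDerivAt
    have h2 := ((hm.smooth.contDiffAt (d₁.isOpen_dom.mem_nhds hz)).differentiableAt
      (by simp)).hasFDerivAt
    rw [(HasFDerivAt.prodMap (p := (y, z)) h1 h2).fderiv]
    exact (hl.immersion y hy).prodMap (hm.immersion z hz)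
  isEmbedding := by
    have h := hl.isEmbedding.prodMap hm.isEmbedding
    exact h.comp (Homeomorph.Set.prod c₁.dom d₁.dom).isEmbedding
  comm := fun y hy => Prod.ext (hl.comm _ hy.1) (hm.comm _ hy.2)

end Prod

end OrbifoldChart

/-- An orbifold structure on the space `X`, given by an orbifold atlas: charts that cover `X` and
are pairwise locally compatible.  The equivalence class of the atlas enters everything below only
through `IsChart`. -/
structure OrbifoldStructure (E : Type*) [NormedAddCommGroup E] [NormedSpace ℝ E]
    (X : Type*) [TopologicalSpace X] where
  atlas : Set (OrbifoldChart E X)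
  covers : ∀ x, ∃ c ∈ atlas, x ∈ c.image
  compatible : ∀ c ∈ atlas, ∀ d ∈ atlas, c.Compatible d

/-- An orbifold with underlying space `X`: a Hausdorff paracompact space with an orbifold
structure.  It is `n`-dimensional when `E` is `ℝⁿ`. -/
structure Orbifold (E : Type*) [NormedAddCommGroup E] [NormedSpace ℝ E]
    (X : Type*) [TopologicalSpace X] extends OrbifoldStructure E X where
  t2 : T2Space X
  paracompact : ParacompactSpace X

namespace OrbifoldStructure

section Basic

variable {E : Type*} [NormedAddCommGroup E] [NormedSpace ℝ E]
  {E' : Type*} [NormedAddCommGroup E'] [NormedSpace ℝ E']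
  {X : Type*} [TopologicalSpace X] {Y : Type*} [TopologicalSpace Y]

/-- `c` is a chart of `O`: it belongs to the maximal atlas, that is, it can be added to the given
atlas. -/
def IsChart (O : OrbifoldStructure E X) (c : OrbifoldChart E X) : Prop :=
  ∀ d ∈ O.atlas, c.Compatible d ∧ d.Compatible c

/-- A smooth local lift of `f` at `x`: charts `(Ũ, Γ_x, φ)` around `x` and `(Ṽ, Γ_{f(x)}, ψ)`
around `f x` with `f(U) ⊆ V`, a homomorphism `Γ_x → Γ_{f(x)}`, and a smooth map `Ũ → Ṽ` that is
equivariant with respect to it and covers `f`. -/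
structure LocalLift (O : OrbifoldStructure E X) (P : OrbifoldStructure E' Y)
    (f : X → Y) (x : X) where
  src : OrbifoldChart E X
  src_isChart : O.IsChart src
  src_around : src.IsAround x
  tgt : OrbifoldChart E' Y
  tgt_isChart : P.IsChart tgt
  tgt_around : tgt.IsAround (f x)
  mapsTo : MapsTo f src.image tgt.image
  hom : src.grp →* tgt.grp
  lift : E → E'
  lift_mapsTo : MapsTo lift src.dom tgt.dom
  lift_smooth : ContDiffOn ℝ ∞ lift src.dom
  equivariant : ∀ g, ∀ y ∈ src.dom, lift (src.act g y) = tgt.act (hom g) (lift y)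
  comm : ∀ y ∈ src.dom, tgt.map (lift y) = f (src.map y)

/-- For open sets `U`, `V`: `f` restricts to a smooth map `O|_U → P|_V` between the open
suborbifolds, whose charts are the charts of `O` inside `U` and the charts of `P` inside `V`. -/
def IsSmoothOn (O : OrbifoldStructure E X) (P : OrbifoldStructure E' Y)
    (U : Set X) (V : Set Y) (f : X → Y) : Prop :=
  MapsTo f U V ∧ ContinuousOn f U ∧
    ∀ x ∈ U, ∃ L : LocalLift O P f x, L.src.image ⊆ U ∧ L.tgt.image ⊆ V

/-- `f` is a smooth map `O → P`: continuous, with a smooth local lift at every point. -/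
def IsSmooth (O : OrbifoldStructure E X) (P : OrbifoldStructure E' Y) (f : X → Y) : Prop :=
  Continuous f ∧ ∀ x, Nonempty (LocalLift O P f x)

/-- For open sets `U`, `V`: `f` restricts to a diffeomorphism `O|_U → P|_V`, i.e. to a smooth map
with a smooth inverse. -/
def IsDiffeoOn (O : OrbifoldStructure E X) (P : OrbifoldStructure E' Y)
    (U : Set X) (V : Set Y) (f : X → Y) : Prop :=
  IsOpen U ∧ IsOpen V ∧ IsSmoothOn O P U V f ∧
    ∃ f' : Y → X, IsSmoothOn P O V U f' ∧ InvOn f' f U V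

/-- `f` is a submersion at `x`: there is a local lift of `f` at `x` such that both its differential
at the point over `x` and the homomorphism of local groups are surjective. -/
def IsSubmersionAt (O : OrbifoldStructure E X) (P : OrbifoldStructure E' Y)
    (f : X → Y) (x : X) : Prop :=
  ∃ L : LocalLift O P f x,
    (∃ y ∈ L.src.dom, L.src.map y = x ∧ Function.Surjective (fderiv ℝ L.lift y)) ∧
    Function.Surjective L.hom

/-- The product orbifold structure, given by the products of charts. -/
def prod (O : OrbifoldStructure E X) (P : OrbifoldStructure E' Y) :
    OrbifoldStructure (E × E') (X × Y) where
  atlas := {e | ∃ c ∈ O.atlas, ∃ d ∈ P.atlas, e = c.prod d}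
  covers := by
    rintro ⟨x, y⟩
    obtain ⟨c, hc, hx⟩ := O.covers x
    obtain ⟨d, hd, hy⟩ := P.covers y
    exact ⟨_, ⟨c, hc, d, hd, rfl⟩, by rw [OrbifoldChart.image_prod]; exact ⟨hx, hy⟩⟩
  compatible := by
    rintro _ ⟨c, hc, d, hd, rfl⟩ _ ⟨c', hc', d', hd', rfl⟩ ⟨x, y⟩ ⟨h, h'⟩
    rw [OrbifoldChart.image_prod] at h h'
    obtain ⟨c₃, hx, ⟨l, hl⟩, ⟨l', hl'⟩⟩ := O.compatible c hc c' hc' x ⟨h.1, h'.1⟩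
    obtain ⟨d₃, hy, ⟨m, hm⟩, ⟨m', hm'⟩⟩ := P.compatible d hd d' hd' y ⟨h.2, h'.2⟩
    exact ⟨c₃.prod d₃, by rw [OrbifoldChart.image_prod]; exact ⟨hx, hy⟩,
      ⟨_, hl.prod hm⟩, ⟨_, hl'.prod hm'⟩⟩

/-- The orbifold structure of a connected open subset `W` of the model space (a manifold). -/
noncomputable def ofOpen (W : Set E) (hW : IsOpen W) (hc : IsConnected W) :
    OrbifoldStructure E W where
  atlas := {OrbifoldChart.ofOpen W hW hc}
  covers := fun x => ⟨_, rfl, x.1, x.2, by simp [OrbifoldChart.ofOpen]⟩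
  compatible := by
    rintro _ rfl _ rfl
    exact .refl _

/-- An action of the finite (discrete) group `G` on the underlying space is a smooth action on the
orbifold: every element acts by a smooth map of orbifolds. -/
def IsSmoothAction (M : OrbifoldStructure E X) (G : Type*) [Group G] [MulAction G X] : Prop :=
  ∀ g : G, IsSmooth M M (fun x => g • x)

/-- For a smooth action of the finite group `G` on `M`, the orbifold structure `Q` on the orbit
space is that of the quotient orbifold `M // G`: the orbit space is covered by charts
`(W̃, K, π ∘ φ)` of `Q`, where `(W̃, L, φ)` is a chart of `M`, `π` is the orbit projection, and the
elements of `K` are lifts to `W̃` of elements of `G`.  (The chart condition on `(W̃, K, π ∘ φ)`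
then forces `K` to contain all such lifts; and `Q` is unique up to equivalence of atlases.) -/
def IsQuotient (M : OrbifoldStructure E X) (G : Type*) [Group G] [MulAction G X]
    (Q : OrbifoldStructure E (Quotient (MulAction.orbitRel G X))) : Prop :=
  M.IsSmoothAction G ∧ ∀ x : X, ∃ c : OrbifoldChart E X, M.IsChart c ∧ x ∈ c.image ∧
    ∃ q : OrbifoldChart E (Quotient (MulAction.orbitRel G X)), Q.IsChart q ∧
      q.dom = c.dom ∧
      (∀ y ∈ c.dom, q.map y = Quotient.mk (MulAction.orbitRel G X) (c.map y)) ∧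
      ∀ k : q.grp, ∃ g : G, ∀ y ∈ c.dom, c.map (q.act k y) = g • c.map y

end Basic

end OrbifoldStructure

/-- For `G` acting on `A` and `B`, the map `(A × B) / G → B / G` induced by the projection, where
`G` acts diagonally on `A × B`. -/
def orbitProj (G A B : Type*) [Group G] [MulAction G A] [MulAction G B] :
    Quotient (MulAction.orbitRel G (A × B)) → Quotient (MulAction.orbitRel G B) :=
  Quotient.map Prod.snd (by
    rintro a b ⟨g, rfl⟩
    exact ⟨g, rfl⟩)

/-! Take a local lift at `x` whose differential and group homomorphism `h` are surjective, and let
`y` be the point over `x`. Both `y` and its image are fixed by the whole chart groups, so the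
differentials of the action at `y` represent `Γ_x` on the kernel of the differential of the lift,
identified with `ℝᵏ`. Averaging a linear projection onto this kernel over `Γ_x` gives an equivariant
map `p` to `ℝᵏ`. By the inverse function theorem `(p, lift)` is an equivariant diffeomorphism from
an invariant neighborhood of `y` onto some `D × V`, on which the lift becomes the projection to `V`
(`exists_equivariant_product`).

The rest is a quotient in two stages. The kernel of `h` acts only on the factor `D`, and `Γ_{f(x)}`
is `Γ_x / ker h`. Hence with `F = D / ker h` the space `(D × V) / Γ_x` is `(F × V) / Γ_{f(x)}`, and
`f` becomes the projection (`exists_bundle_of_equivariant_product`). Effectiveness survives: an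
element of `ker h` trivial on `D` is trivial on `D × V`.

Shrinking charts requires the group to stay effective on a smaller open set. This is the rigidity of
finite smooth actions on connected domains, `eq_one_of_eventually_act_eq_self`. Smoothness of maps
is then read off from equivariant lifts between charts, with local lifts obtained by restricting to
slices. -/

namespace OrbifoldChart

/-! ### Rigidity of chart groups, slices and restriction of charts. -/

section Rigidity

variable {E : Type*} [NormedAddCommGroup E] [NormedSpace ℝ E]
  {X : Type*} [TopologicalSpace X]

lemma isOpen_image (c : OrbifoldChart E X) : IsOpen c.image :=
  c.map_isOpen _ subset_rfl c.isOpen_dom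

lemma contDiffAt_act (c : OrbifoldChart E X) (g : c.grp) {y : E} (hy : y ∈ c.dom) :
    ContDiffAt ℝ ∞ (c.act g) y :=
  (c.act_smooth g).contDiffAt (c.isOpen_dom.mem_nhds hy)

lemma act_inv_act (c : OrbifoldChart E X) (g : c.grp) {y : E} (hy : y ∈ c.dom) :
    c.act g⁻¹ (c.act g y) = y := by
  rw [← c.act_mul _ _ y hy, inv_mul_cancel, c.act_one y hy]

lemma act_act_inv (c : OrbifoldChart E X) (g : c.grp) {y : E} (hy : y ∈ c.dom) :
    c.act g (c.act g⁻¹ y) = y := by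
  rw [← c.act_mul _ _ y hy, mul_inv_cancel, c.act_one y hy]

/-- A group element that fixes a point with trivial differential acts trivially near the point. -/
lemma eventually_act_eq_self [CompleteSpace E] (c : OrbifoldChart E X) (g : c.grp) {z : E}
    (hz : z ∈ c.dom) (hgz : c.act g z = z)
    (hd : HasFDerivAt (c.act g) (ContinuousLinearMap.id ℝ E) z) :
    ∀ᶠ y in 𝓝 z, c.act g y = y := by
  have hdom := c.isOpen_dom.mem_nhds hz
  have key : ∀ i : ℕ, c.act (g ^ i) z = z ∧
      HasFDerivAt (c.act (g ^ i)) (ContinuousLinearMap.id ℝ E) z := by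
    intro i
    induction i with
    | zero =>
      rw [pow_zero]
      refine ⟨c.act_one z hz, (hasFDerivAt_id z).congr_of_eventuallyEq ?_⟩
      filter_upwards [hdom] with y hy using c.act_one y hy
    | succ i ih =>
      rw [pow_succ']
      refine ⟨by rw [c.act_mul _ _ z hz, ih.1, hgz], ?_⟩
      have h1 : HasFDerivAt (c.act g ∘ c.act (g ^ i))
          ((ContinuousLinearMap.id ℝ E).comp (ContinuousLinearMap.id ℝ E)) z :=
        HasFDerivAt.comp z (by rw [ih.1]; exact hd) ih.2
      rw [ContinuousLinearMap.id_comp] at h1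
      refine h1.congr_of_eventuallyEq ?_
      filter_upwards [hdom] with y hy using c.act_mul _ _ y hy
  set N := orderOf g with hN
  have hpos : 0 < N := orderOf_pos g
  have hN0 : (N : ℝ) ≠ 0 := by exact_mod_cast hpos.ne'
  -- `S` sums over the cyclic group generated by `g`, so it is unchanged by precomposition with `g`.
  -- Its derivative at `z` is `N` times the identity, so it is injective near `z`; together these
  -- force `g` to fix nearby points.
  let S : E → E := fun y => ∑ i ∈ Finset.range N, c.act (g ^ i) y
  let e : E ≃L[ℝ] E := ContinuousLinearEquiv.smulLeft (Units.mk0 (N : ℝ) hN0)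
  have hS : HasFDerivAt S (e : E →L[ℝ] E) z := by
    have h1 : HasFDerivAt S (∑ i ∈ Finset.range N, ContinuousLinearMap.id ℝ E) z :=
      HasFDerivAt.fun_sum fun i _ => (key i).2
    convert h1 using 1
    ext v
    simp [e, ← Nat.cast_smul_eq_nsmul ℝ, Units.smul_def]
  have hSc : ContDiffAt ℝ ∞ S z := ContDiffAt.sum fun i _ => c.contDiffAt_act _ hz
  let φ := hSc.toOpenPartialHomeomorph S hS (by simp)
  have hsrc : φ.source ∈ 𝓝 z :=
    φ.open_source.mem_nhds (hSc.mem_toOpenPartialHomeomorph_source hS (by simp))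
  have hcont : Filter.Tendsto (c.act g) (𝓝 z) (𝓝 z) := by
    have := (c.contDiffAt_act g hz).continuousAt
    rwa [ContinuousAt, hgz] at this
  filter_upwards [hsrc, hcont hsrc, hdom] with y hy1 hy2 hy3
  refine φ.injOn hy2 hy1 ?_
  change S (c.act g y) = S y
  have h1 : S (c.act g y) = ∑ i ∈ Finset.range N, c.act (g ^ (i + 1)) y :=
    Finset.sum_congr rfl fun i _ => by rw [pow_succ, c.act_mul _ _ y hy3]
  -- The sum of `N + 1` terms is split at its last and at its first term; these agree because `g ^ N
  -- = 1`, and cancel.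
  have h2 := Finset.sum_range_succ (fun i => c.act (g ^ i) y) N
  rw [Finset.sum_range_succ', hN, pow_orderOf_eq_one, pow_zero] at h2
  rw [h1]
  exact add_right_cancel h2

/-- A group element that acts trivially near one point of the domain is the identity. -/
lemma eq_one_of_eventually_act_eq_self [CompleteSpace E] (c : OrbifoldChart E X) (g : c.grp)
    {z : E} (hz : z ∈ c.dom) (h : ∀ᶠ y in 𝓝 z, c.act g y = y) : g = 1 := by
  apply c.act_effective g
  -- `A` is open by construction. It is relatively closed in the domain: fixing the point and having
  -- identity differential both pass to limits, and the averaging argument turns them back into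
  -- triviality nearby.
  let A : Set E := {z | ∀ᶠ y in 𝓝 z, c.act g y = y}
  suffices hA : c.dom ⊆ A from fun y hy => (hA hy).self_of_nhds
  have hAo : IsOpen A := isOpen_setOfPred_eventually_nhds
  refine c.isConnected_dom.isPreconnected.subset_of_closure_inter_subset hAo ⟨z, hz, h⟩ ?_
  rintro w ⟨hwA, hw⟩
  have hfr : ∃ᶠ y in 𝓝 w, y ∈ A := mem_closure_iff_frequently.1 hwA
  have hc := (c.contDiffAt_act g hw)
  have hfix : c.act g w = w := by
    by_contra hne
    have h1 : ∀ᶠ y in 𝓝 w, c.act g y - y ≠ 0 :=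
      (hc.continuousAt.sub continuousAt_id).eventually_ne (sub_ne_zero.2 hne)
    obtain ⟨y, hy, hy'⟩ := (hfr.and_eventually h1).exists
    exact hy' (sub_eq_zero.2 hy.self_of_nhds)
  have hder : fderiv ℝ (c.act g) w = ContinuousLinearMap.id ℝ E := by
    by_contra hne
    have h0 : ContinuousAt (fderiv ℝ (c.act g)) w :=
      ((c.act_smooth g).continuousOn_fderiv_of_isOpen c.isOpen_dom (by simp)).continuousAt
        (c.isOpen_dom.mem_nhds hw)
    have h1 : ∀ᶠ y in 𝓝 w, fderiv ℝ (c.act g) y ≠ ContinuousLinearMap.id ℝ E :=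
      h0.eventually_ne hne
    obtain ⟨y, hy, hy'⟩ := (hfr.and_eventually h1).exists
    have h2 : c.act g =ᶠ[𝓝 y] id := hy
    exact hy' (by rw [h2.fderiv_eq, fderiv_id])
  refine c.eventually_act_eq_self g hw hfix ?_
  rw [← hder]
  exact (hc.differentiableAt (by simp)).hasFDerivAt

/-- Restriction of a chart to an open connected subset `W` of its domain, with the subgroup (given
as an injective homomorphism) of the group elements that do not move `W` off itself. -/
def restrict [CompleteSpace E] (c : OrbifoldChart E X) (W : Set E) (hW : IsOpen W)
    (hWc : IsConnected W) (hWs : W ⊆ c.dom) (K : Type) [Group K] [Finite K] (j : K →* c.grp)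
    (hj : Function.Injective j) (hm : ∀ k, MapsTo (c.act (j k)) W W)
    (hr : ∀ g, ∀ y ∈ W, c.act g y ∈ W → g ∈ j.range) : OrbifoldChart E X where
  dom := W
  isOpen_dom := hW
  isConnected_dom := hWc
  grp := K
  act := fun k => c.act (j k)
  act_mapsTo := hm
  act_one := fun y hy => by rw [map_one]; exact c.act_one y (hWs hy)
  act_mul := fun g h y hy => by rw [map_mul]; exact c.act_mul _ _ y (hWs hy)
  act_smooth := fun h => (c.act_smooth _).mono hWs
  act_effective := fun h hh => by
    obtain ⟨z, hz⟩ := hWc.nonempty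
    refine hj ?_
    rw [map_one]
    refine c.eq_one_of_eventually_act_eq_self _ (hWs hz) ?_
    filter_upwards [hW.mem_nhds hz] with y hy using hh y hy
  map := c.map
  map_continuousOn := c.map_continuousOn.mono hWs
  map_act := fun h y hy => c.map_act _ y (hWs hy)
  exists_act_eq := fun y hy z hz h => by
    obtain ⟨g, hg⟩ := c.exists_act_eq y (hWs hy) z (hWs hz) h
    obtain ⟨k, rfl⟩ := hr g y hy (by rwa [hg])
    exact ⟨k, hg⟩
  map_isOpen := fun V hV ho => c.map_isOpen V (hV.trans hWs) ho

/-- Every point of a chart domain has arbitrarily small connected open neighborhoods that are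
invariant under the stabilizer of the point and are moved off themselves by all other elements. -/
lemma exists_slice (c : OrbifoldChart E X) {y : E} (hy : y ∈ c.dom) {T : Set E} (hT : T ∈ 𝓝 y) :
    ∃ W, IsOpen W ∧ IsConnected W ∧ W ⊆ c.dom ∧ W ⊆ T ∧ y ∈ W ∧
      (∀ g, c.act g y = y → MapsTo (c.act g) W W) ∧
      (∀ g, ∀ z ∈ W, c.act g z ∈ W → c.act g y = y) := by
  classical
  have hsep : ∀ g : c.grp, ∃ A ∈ 𝓝 y, c.act g y ≠ y → ∀ z ∈ A, c.act g z ∉ A := by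
    intro g
    by_cases hg : c.act g y = y
    · exact ⟨univ, Filter.univ_mem, fun h => absurd hg h⟩
    obtain ⟨u, v, hu, hv, hyu, hyv, huv⟩ := t2_separation hg
    refine ⟨v ∩ c.act g ⁻¹' u, Filter.inter_mem (hv.mem_nhds hyv)
      ((c.contDiffAt_act g hy).continuousAt (hu.mem_nhds hyu)), fun _ z hz hz' => ?_⟩
    exact disjoint_left.1 huv hz.2 hz'.1
  choose A hA hA' using hsep
  let T' : Set E := interior (T ∩ ⋂ g, A g)
  have hT' : y ∈ T' := mem_interior_iff_mem_nhds.2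
    (Filter.inter_mem hT (Filter.iInter_mem.2 hA))
  -- Intersecting over the stabilizer makes `R` invariant under it. The component of `R` at `y` is
  -- then invariant too, since the stabilizer fixes `y`.
  let R : Set E := ⋂ g : {g // c.act g y = y}, c.dom ∩ c.act g.1 ⁻¹' T'
  have hRo : IsOpen R := isOpen_iInter_of_finite fun g =>
    (c.act_smooth g.1).continuousOn.isOpen_inter_preimage c.isOpen_dom isOpen_interior
  have hyR : y ∈ R := mem_iInter.2 fun g => ⟨hy, by simpa [g.2] using hT'⟩
  have h1 : c.act 1 y = y := c.act_one y hy
  have hRd : R ⊆ c.dom := fun z hz => (mem_iInter.1 hz ⟨1, h1⟩).1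
  have hRT : R ⊆ T' := fun z hz => by
    have := (mem_iInter.1 hz ⟨1, h1⟩).2
    rwa [mem_preimage, c.act_one z (hRd hz)] at this
  let W := connectedComponentIn R y
  have hWR : W ⊆ R := connectedComponentIn_subset R y
  have hyW : y ∈ W := mem_connectedComponentIn hyR
  refine ⟨W, hRo.connectedComponentIn, isConnected_connectedComponentIn_iff.2 hyR,
    hWR.trans hRd, fun z hz => (interior_subset (hRT (hWR hz))).1, hyW, ?_, ?_⟩
  · intro g hg
    rw [mapsTo_iff_image_subset]
    refine IsPreconnected.subset_connectedComponentIn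
      (isPreconnected_connectedComponentIn.image _
        ((c.act_smooth g).continuousOn.mono (hWR.trans hRd))) ⟨y, hyW, hg⟩ ?_
    rintro _ ⟨z, hz, rfl⟩
    refine mem_iInter.2 fun s => ⟨c.act_mapsTo g (hRd (hWR hz)), ?_⟩
    have hs : c.act (s.1 * g) y = y := by rw [c.act_mul _ _ y hy, hg, s.2]
    have := (mem_iInter.1 (hWR hz) ⟨s.1 * g, hs⟩).2
    rwa [mem_preimage, c.act_mul _ _ z (hRd (hWR hz))] at this
  · intro g z hz hgz
    by_contra hne
    exact hA' g hne z (mem_iInter.1 (interior_subset (hRT (hWR hz))).2 g)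
      (mem_iInter.1 (interior_subset (hRT (hWR hgz))).2 g)

/-- The stabilizer of a point in the chart group. -/
def stab (c : OrbifoldChart E X) {y : E} (hy : y ∈ c.dom) : Subgroup c.grp where
  carrier := {g | c.act g y = y}
  one_mem' := c.act_one y hy
  mul_mem' := fun {a b} ha hb => by
    change c.act (a * b) y = y
    rw [c.act_mul _ _ y hy, show c.act b y = y from hb, show c.act a y = y from ha]
  inv_mem' := fun {a} ha => by
    change c.act a⁻¹ y = y
    conv_lhs => rw [← show c.act a y = y from ha]
    exact c.act_inv_act a hy

@[simp] lemma mem_stab (c : OrbifoldChart E X) {y : E} (hy : y ∈ c.dom) {g : c.grp} :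
    g ∈ c.stab hy ↔ c.act g y = y := Iff.rfl

/-- Restriction of a chart to a slice at a point. -/
def restrictSlice [CompleteSpace E] (c : OrbifoldChart E X) {y : E} (hy : y ∈ c.dom) (W : Set E)
    (hW : IsOpen W) (hWc : IsConnected W) (hWs : W ⊆ c.dom)
    (hm : ∀ g, c.act g y = y → MapsTo (c.act g) W W)
    (hr : ∀ g, ∀ z ∈ W, c.act g z ∈ W → c.act g y = y) : OrbifoldChart E X :=
  c.restrict W hW hWc hWs (c.stab hy) (c.stab hy).subtype Subtype.val_injective
    (fun k => hm k.1 k.2) (fun g z hz hz' => by simpa using hr g z hz hz')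

lemma isAround_restrictSlice [CompleteSpace E] (c : OrbifoldChart E X) {y : E} (hy : y ∈ c.dom)
    (W : Set E) (hW : IsOpen W) (hWc : IsConnected W) (hWs : W ⊆ c.dom)
    (hm : ∀ g, c.act g y = y → MapsTo (c.act g) W W)
    (hr : ∀ g, ∀ z ∈ W, c.act g z ∈ W → c.act g y = y) (hyW : y ∈ W) :
    (c.restrictSlice hy W hW hWc hWs hm hr).IsAround (c.map y) := by
  refine ⟨y, ⟨hyW, rfl⟩, ?_⟩
  rintro z ⟨hz, hzy⟩
  obtain ⟨g, hg⟩ := c.exists_act_eq y hy z (hWs hz) (Eq.symm hzy)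
  rw [← hg]
  exact hr g y hyW (by rw [hg]; exact hz)

/-- The inclusion of a restricted chart is an embedding. -/
lemma isChartEmbedding_restrict [CompleteSpace E] (c : OrbifoldChart E X) (W : Set E)
    (hW : IsOpen W) (hWc : IsConnected W) (hWs : W ⊆ c.dom) (K : Type) [Group K] [Finite K]
    (j : K →* c.grp) (hj : Function.Injective j) (hm : ∀ k, MapsTo (c.act (j k)) W W)
    (hr : ∀ g, ∀ y ∈ W, c.act g y ∈ W → g ∈ j.range) :
    IsChartEmbedding (c.restrict W hW hWc hWs K j hj hm hr) c id where
  mapsTo := hWs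
  smooth := contDiffOn_id
  immersion := fun y _ => by
    rw [fderiv_id]
    exact Function.injective_id
  isEmbedding := IsEmbedding.subtypeVal
  comm := fun _ _ => rfl

lemma IsChartEmbedding.comp {c₁ c₂ c₃ : OrbifoldChart E X} {l m : E → E}
    (hl : IsChartEmbedding c₁ c₂ l) (hm : IsChartEmbedding c₂ c₃ m) :
    IsChartEmbedding c₁ c₃ (m ∘ l) where
  mapsTo := hm.mapsTo.comp hl.mapsTo
  smooth := hm.smooth.comp hl.smooth hl.mapsTo
  immersion := fun y hy => by
    have h1 := (hl.smooth.contDiffAt (c₁.isOpen_dom.mem_nhds hy)).differentiableAt (by simp)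
    have h2 := (hm.smooth.contDiffAt (c₂.isOpen_dom.mem_nhds (hl.mapsTo hy))).differentiableAt
      (by simp)
    rw [fderiv_comp y h2 h1]
    exact (hm.immersion _ (hl.mapsTo hy)).comp (hl.immersion y hy)
  isEmbedding := by
    have h1 : IsEmbedding (hl.mapsTo.restrict l c₁.dom c₂.dom) :=
      IsEmbedding.of_comp (hl.smooth.continuousOn.mapsToRestrict hl.mapsTo)
        continuous_subtype_val hl.isEmbedding
    exact hm.isEmbedding.comp h1
  comm := fun y hy => by
    rw [Function.comp_apply, hm.comm _ (hl.mapsTo hy), hl.comm y hy]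

/-- The inverse is the action of `g⁻¹`, and the chain rule gives injectivity of the differential. It
serves to move an embedding to another sheet over the same open set. -/
lemma isChartEmbedding_act (c : OrbifoldChart E X) (g : c.grp) : IsChartEmbedding c c (c.act g) where
  mapsTo := c.act_mapsTo g
  smooth := c.act_smooth g
  immersion := fun y hy => by
    have h1 := ((c.contDiffAt_act g hy).differentiableAt (by simp)).hasFDerivAt
    have h2 := ((c.contDiffAt_act g⁻¹ (c.act_mapsTo g hy)).differentiableAt
      (by simp)).hasFDerivAt
    have h3 : HasFDerivAt (c.act g⁻¹ ∘ c.act g) (ContinuousLinearMap.id ℝ E) y :=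
      (hasFDerivAt_id y).congr_of_eventuallyEq (by
        filter_upwards [c.isOpen_dom.mem_nhds hy] with z hz using c.act_inv_act g hz)
    have h4 := (h2.comp y h1).unique h3
    intro v w hvw
    have := congrArg (fderiv ℝ (c.act g⁻¹) (c.act g y)) hvw
    rw [← ContinuousLinearMap.comp_apply, ← ContinuousLinearMap.comp_apply, h4] at this
    exact this
  isEmbedding := by
    let e : c.dom ≃ₜ c.dom :=
      { toFun := (c.act_mapsTo g).restrict
        invFun := (c.act_mapsTo g⁻¹).restrict
        left_inv := fun z => Subtype.ext (c.act_inv_act g z.2)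
        right_inv := fun z => Subtype.ext (c.act_act_inv g z.2)
        continuous_toFun := (c.act_smooth g).continuousOn.mapsToRestrict _
        continuous_invFun := (c.act_smooth g⁻¹).continuousOn.mapsToRestrict _ }
    exact IsEmbedding.subtypeVal.comp e.isEmbedding
  comm := fun y hy => c.map_act g y hy

/-- An embedding with image in the domain of a restricted chart is an embedding in it. -/
lemma IsChartEmbedding.codRestrict [CompleteSpace E] {d c : OrbifoldChart E X} {l : E → E}
    (hl : IsChartEmbedding d c l) (W : Set E)
    (hW : IsOpen W) (hWc : IsConnected W) (hWs : W ⊆ c.dom) (K : Type) [Group K] [Finite K]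
    (j : K →* c.grp) (hj : Function.Injective j) (hm : ∀ k, MapsTo (c.act (j k)) W W)
    (hr : ∀ g, ∀ y ∈ W, c.act g y ∈ W → g ∈ j.range) (h : MapsTo l d.dom W) :
    IsChartEmbedding d (c.restrict W hW hWc hWs K j hj hm hr) l where
  mapsTo := h
  smooth := hl.smooth
  immersion := hl.immersion
  isEmbedding := hl.isEmbedding
  comm := hl.comm

lemma Compatible.symm {c d : OrbifoldChart E X} (h : c.Compatible d) : d.Compatible c :=
  fun x hx => by
    obtain ⟨e, he, h1, h2⟩ := h x hx.symm
    exact ⟨e, he, h2, h1⟩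

lemma Compatible.restrict [CompleteSpace E] {d c : OrbifoldChart E X} (hcd : c.Compatible d)
    (W : Set E)
    (hW : IsOpen W) (hWc : IsConnected W) (hWs : W ⊆ c.dom) (K : Type) [Group K] [Finite K]
    (j : K →* c.grp) (hj : Function.Injective j) (hm : ∀ k, MapsTo (c.act (j k)) W W)
    (hr : ∀ g, ∀ y ∈ W, c.act g y ∈ W → g ∈ j.range) :
    (c.restrict W hW hWc hWs K j hj hm hr).Compatible d := by
  rintro x ⟨⟨w, hw, hwx⟩, hxd⟩
  replace hwx : c.map w = x := hwx
  replace hw : w ∈ W := hw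
  obtain ⟨e, ⟨y, hy, rfl⟩, ⟨l, hl⟩, ⟨m, hm'⟩⟩ := hcd x ⟨⟨w, hWs hw, hwx⟩, hxd⟩
  -- The common chart may embed around a translate of `w` outside `W`. Composing with `g` brings its
  -- base point to `w`, and a small slice of the common chart then lands in `W`.
  obtain ⟨g, hg⟩ := c.exists_act_eq (l y) (hl.mapsTo hy) w (hWs hw) (by rw [hl.comm y hy, hwx])
  have hl' := hl.comp (c.isChartEmbedding_act g)
  have hcont : ContinuousAt (c.act g ∘ l) y :=
    hl'.smooth.continuousOn.continuousAt (e.isOpen_dom.mem_nhds hy)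
  obtain ⟨T, hT, hTc, hTd, hTT, hyT, hst, hsep⟩ := e.exists_slice hy
    (hcont (hW.mem_nhds (show (c.act g ∘ l) y ∈ W by simpa [hg] using hw)))
  refine ⟨e.restrictSlice hy T hT hTc hTd hst hsep, ⟨y, hyT, rfl⟩,
    ⟨c.act g ∘ l, ?_⟩, ⟨m, ?_⟩⟩
  · exact ((e.isChartEmbedding_restrict T hT hTc hTd _ _ _ _ _).comp hl').codRestrict _ _ _ _ _ _ _ _
      _ hTT
  · exact (e.isChartEmbedding_restrict T hT hTc hTd _ _ _ _ _).comp hm'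

end Rigidity

end OrbifoldChart

/-! ### Smooth maps and diffeomorphisms from equivariant lifts. -/

namespace OrbifoldStructure

section Lifts

variable {E : Type*} [NormedAddCommGroup E] [NormedSpace ℝ E] [CompleteSpace E]
  {E' : Type*} [NormedAddCommGroup E'] [NormedSpace ℝ E'] [CompleteSpace E']
  {X : Type*} [TopologicalSpace X] {Y : Type*} [TopologicalSpace Y]

lemma IsChart.restrict {O : OrbifoldStructure E X} {c : OrbifoldChart E X} (hc : O.IsChart c)
    (W : Set E)
    (hW : IsOpen W) (hWc : IsConnected W) (hWs : W ⊆ c.dom) (K : Type) [Group K] [Finite K]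
    (j : K →* c.grp) (hj : Function.Injective j) (hm : ∀ k, MapsTo (c.act (j k)) W W)
    (hr : ∀ g, ∀ y ∈ W, c.act g y ∈ W → g ∈ j.range) :
    O.IsChart (c.restrict W hW hWc hWs K j hj hm hr) := fun d hd =>
  ⟨(hc d hd).1.restrict _ _ _ _ _ _ _ _ _, ((hc d hd).1.restrict _ _ _ _ _ _ _ _ _).symm⟩

/-- A map with an equivariant smooth lift between charts restricts to a smooth map between their
images. -/
lemma isSmoothOn_of_lift {O : OrbifoldStructure E X} {P : OrbifoldStructure E' Y}
    {c : OrbifoldChart E X} {d : OrbifoldChart E' Y} (hc : O.IsChart c) (hd : P.IsChart d)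
    {f : X → Y} (h : c.grp →* d.grp) (l : E → E') (hl : MapsTo l c.dom d.dom)
    (hls : ContDiffOn ℝ ∞ l c.dom)
    (heq : ∀ g, ∀ y ∈ c.dom, l (c.act g y) = d.act (h g) (l y))
    (hcomm : ∀ y ∈ c.dom, d.map (l y) = f (c.map y)) :
    IsSmoothOn O P c.image d.image f := by
  refine ⟨?_, ?_, ?_⟩
  · rintro _ ⟨y, hy, rfl⟩
    exact ⟨l y, hl hy, hcomm y hy⟩
  · rw [continuousOn_open_iff c.isOpen_image]
    intro T hT
    -- Continuity of `f` follows from that of the lift because the chart map `c.map` is open.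
    have : c.image ∩ f ⁻¹' T = c.map '' (c.dom ∩ (d.map ∘ l) ⁻¹' T) := by
      ext x
      constructor
      · rintro ⟨⟨y, hy, rfl⟩, hx⟩
        exact ⟨y, ⟨hy, by simpa [hcomm y hy] using hx⟩, rfl⟩
      · rintro ⟨y, ⟨hy, hy'⟩, rfl⟩
        exact ⟨⟨y, hy, rfl⟩, by simpa [hcomm y hy] using hy'⟩
    change IsOpen (c.image ∩ f ⁻¹' T)
    rw [this]
    exact c.map_isOpen _ inter_subset_left
      ((d.map_continuousOn.comp hls.continuousOn hl).isOpen_inter_preimage c.isOpen_dom hT)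
  · rintro _ ⟨y, hy, rfl⟩
    -- Charts around the two points are needed, so both are cut down to slices, the source slice
    -- small enough to map into `V`. By equivariance `h` sends the stabilizer of `y` into that of `l
    -- y`.
    obtain ⟨V, hV, hVc, hVd, -, hyV, hst, hsep⟩ := d.exists_slice (hl hy) Filter.univ_mem
    obtain ⟨W, hW, hWc, hWd, hWT, hyW, hst', hsep'⟩ := c.exists_slice hy
      ((hls.continuousOn.continuousAt (c.isOpen_dom.mem_nhds hy)) (hV.mem_nhds hyV))
    refine ⟨{ src := c.restrictSlice hy W hW hWc hWd hst' hsep'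
              src_isChart := hc.restrict _ _ _ _ _ _ _ _ _
              src_around := c.isAround_restrictSlice hy W hW hWc hWd hst' hsep' hyW
              tgt := d.restrictSlice (hl hy) V hV hVc hVd hst hsep
              tgt_isChart := hd.restrict _ _ _ _ _ _ _ _ _
              tgt_around := ?_
              mapsTo := ?_
              hom := (h.comp (c.stab hy).subtype).codRestrict (d.stab (hl hy)) ?_
              lift := l
              lift_mapsTo := hWT
              lift_smooth := hls.mono hWd
              equivariant := fun g z hz => heq g.1 z (hWd hz)
              comm := fun z hz => hcomm z (hWd hz) }, image_mono hWd, image_mono hVd⟩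
    · rw [← hcomm y hy]
      exact d.isAround_restrictSlice (hl hy) V hV hVc hVd hst hsep hyV
    · rintro _ ⟨z, hz, rfl⟩
      exact ⟨l z, hWT hz, hcomm z (hWd hz)⟩
    · intro g
      change d.act (h g.1) (l y) = l y
      rw [← heq g.1 y hy, g.2]

omit [CompleteSpace E] [CompleteSpace E'] in
lemma IsSmoothOn.isSmooth {O : OrbifoldStructure E X} {P : OrbifoldStructure E' Y} {f : X → Y}
    {V : Set Y} (h : IsSmoothOn O P univ V f) : IsSmooth O P f :=
  ⟨continuousOn_univ.1 h.2.1, fun x => ⟨(h.2.2 x (mem_univ x)).choose⟩⟩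

/-- A map covered by an equivariant diffeomorphism between the domains of two charts is a
diffeomorphism between their images. -/
lemma isDiffeoOn_of_lift {O : OrbifoldStructure E X} {P : OrbifoldStructure E' Y}
    {c : OrbifoldChart E X} {d : OrbifoldChart E' Y} (hc : O.IsChart c) (hd : P.IsChart d)
    {f : X → Y} (h : c.grp ≃* d.grp) (l : E → E') (l' : E' → E)
    (hl : MapsTo l c.dom d.dom) (hl' : MapsTo l' d.dom c.dom)
    (hls : ContDiffOn ℝ ∞ l c.dom) (hls' : ContDiffOn ℝ ∞ l' d.dom)
    (hinv : InvOn l' l c.dom d.dom)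
    (heq : ∀ g, ∀ y ∈ c.dom, l (c.act g y) = d.act (h g) (l y))
    (hcomm : ∀ y ∈ c.dom, d.map (l y) = f (c.map y)) :
    IsDiffeoOn O P c.image d.image f := by
  classical
  obtain ⟨y₀, hy₀⟩ := c.isConnected_dom.nonempty
  -- The chosen preimage is immaterial, as `l'` is equivariant and `c.map` invariant. The value off
  -- `d.image` is a dummy.
  let f' : Y → X := fun x => if hx : x ∈ d.image then c.map (l' hx.choose) else c.map y₀
  have heq' : ∀ g, ∀ z ∈ d.dom, l' (d.act g z) = c.act (h.symm g) (l' z) := by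
    intro g z hz
    have h1 := heq (h.symm g) (l' z) (hl' hz)
    rw [hinv.2 hz, h.apply_symm_apply] at h1
    rw [← h1, hinv.1 (c.act_mapsTo _ (hl' hz))]
  have hcomm' : ∀ z ∈ d.dom, c.map (l' z) = f' (d.map z) := by
    intro z hz
    have hx : d.map z ∈ d.image := ⟨z, hz, rfl⟩
    simp only [f', dif_pos hx]
    obtain ⟨g, hg⟩ := d.exists_act_eq _ hx.choose_spec.1 z hz hx.choose_spec.2
    conv_lhs => rw [← hg]
    rw [heq' _ _ hx.choose_spec.1, c.map_act _ _ (hl' hx.choose_spec.1)]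
  refine ⟨c.isOpen_image, d.isOpen_image,
    isSmoothOn_of_lift hc hd h.toMonoidHom l hl hls heq hcomm, f',
    isSmoothOn_of_lift hd hc h.symm.toMonoidHom l' hl' hls' heq' hcomm', ?_, ?_⟩
  · rintro _ ⟨y, hy, rfl⟩
    rw [← hcomm y hy, ← hcomm' _ (hl hy), hinv.1 hy]
  · rintro _ ⟨z, hz, rfl⟩
    rw [← hcomm' z hz, ← hcomm _ (hl' hz), hinv.2 hz]

end Lifts

end OrbifoldStructure

/-! ### Orbit spaces taken in two stages. -/

section Quotients

/-- Local compactness and second countability yield paracompactness, and are recorded so that the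
result can be applied again to a quotient of a product with a quotient. -/
lemma t2Space_and_paracompactSpace_quotient (G T : Type*) [Group G] [Finite G]
    [TopologicalSpace T] [MulAction G T] [ContinuousConstSMul G T] [T2Space T]
    [LocallyCompactSpace T] [SecondCountableTopology T] :
    T2Space (Quotient (MulAction.orbitRel G T)) ∧
      LocallyCompactSpace (Quotient (MulAction.orbitRel G T)) ∧
      SecondCountableTopology (Quotient (MulAction.orbitRel G T)) ∧
      ParacompactSpace (Quotient (MulAction.orbitRel G T)) := by
  have h1 : T2Space (Quotient (MulAction.orbitRel G T)) := inferInstance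
  have h2 : LocallyCompactSpace (Quotient (MulAction.orbitRel G T)) :=
    IsOpenQuotientMap.locallyCompactSpace (f := Quotient.mk (MulAction.orbitRel G T))
      ⟨Quotient.mk_surjective, continuous_quotient_mk', isOpenMap_quotient_mk'_mul⟩
  have h3 : SecondCountableTopology (Quotient (MulAction.orbitRel G T)) :=
    ContinuousConstSMul.secondCountableTopology
  exact ⟨h1, h2, h3, inferInstance⟩

variable {Γ G D V : Type*} [Group Γ] [Group G] [MulAction Γ D] [MulAction G V] (h : Γ →* G)

/-- For a surjective homomorphism `h : Γ → G`, the action of `G` on the orbit space of `ker h`. -/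
@[reducible] noncomputable def kerQuotientAction (D : Type*) [MulAction Γ D]
    (hs : Function.Surjective h) : MulAction G (Quotient (MulAction.orbitRel h.ker D)) :=
  -- Neither the choice of lift of an element of `G` nor that of a representative matters, since `γ
  -- * n * δ⁻¹` lies in the kernel. This also gives the action axioms, although `surjInv` is not
  -- multiplicative.
  have key : ∀ γ δ : Γ, h γ = h δ → ∀ d e : D, MulAction.orbitRel h.ker D d e →
      MulAction.orbitRel h.ker D (γ • d) (δ • e) := by
    rintro γ δ hγδ _ e ⟨n, rfl⟩
    refine ⟨⟨γ * n * δ⁻¹, ?_⟩, ?_⟩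
    · rw [MonoidHom.mem_ker, map_mul, map_mul, map_inv, (MonoidHom.mem_ker).1 n.2, hγδ]
      group
    · change (γ * n * δ⁻¹) • δ • e = γ • (n : Γ) • e
      simp [mul_smul]
  { smul := fun g => Quotient.map (fun d => Function.surjInv hs g • d) (key _ _ rfl)
    one_smul := by
      rintro ⟨d⟩
      refine Quotient.sound (s := MulAction.orbitRel h.ker D) ?_
      have := key (Function.surjInv hs 1) 1 (by rw [Function.surjInv_eq hs, map_one]) d d
        ((MulAction.orbitRel h.ker D).refl d)
      rwa [one_smul] at this
    mul_smul := by
      rintro g g' ⟨d⟩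
      refine Quotient.sound (s := MulAction.orbitRel h.ker D) ?_
      have := key (Function.surjInv hs (g * g')) (Function.surjInv hs g * Function.surjInv hs g')
        (by rw [map_mul, Function.surjInv_eq hs, Function.surjInv_eq hs,
          Function.surjInv_eq hs]) d d
        ((MulAction.orbitRel h.ker D).refl d)
      rwa [mul_smul] at this }

lemma kerQuotientAction_smul_mk (hs : Function.Surjective h) (γ : Γ) (d : D) :
    letI := kerQuotientAction h D hs
    h γ • (Quotient.mk (MulAction.orbitRel h.ker D) d) =
      Quotient.mk (MulAction.orbitRel h.ker D) (γ • d) := by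
  refine Quotient.sound (s := MulAction.orbitRel h.ker D) ?_
  refine ⟨⟨Function.surjInv hs (h γ) * γ⁻¹, ?_⟩, ?_⟩
  · rw [MonoidHom.mem_ker, map_mul, Function.surjInv_eq hs, map_inv, mul_inv_cancel]
  · change (Function.surjInv hs (h γ) * γ⁻¹) • γ • d = _
    simp [mul_smul]

variable [MulAction G (Quotient (MulAction.orbitRel h.ker D))]

/-- The projection of `D × V` to the quotient by `G` of `(D / ker h) × V`. -/
def mkProd (p : D × V) :
    Quotient (MulAction.orbitRel G (Quotient (MulAction.orbitRel h.ker D) × V)) :=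
  Quotient.mk _ (Quotient.mk _ p.1, p.2)

lemma mkProd_surjective : Function.Surjective (mkProd h (D := D) (V := V)) := by
  rintro ⟨⟨d⟩, v⟩
  exact ⟨(d, v), rfl⟩

variable (hsmul : ∀ (γ : Γ) (d : D), h γ • (Quotient.mk (MulAction.orbitRel h.ker D) d) =
      Quotient.mk (MulAction.orbitRel h.ker D) (γ • d))

include hsmul

lemma mkProd_smul (γ : Γ) (d : D) (v : V) : mkProd h (γ • d, h γ • v) = mkProd h (d, v) :=
  Quotient.sound (s := MulAction.orbitRel G _) ⟨h γ, Prod.ext (hsmul γ d) rfl⟩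

/-- The element of `G` relating the two points lifts to `Γ`. The lift matches the `D` components
only up to `ker h`, and correcting it by a kernel element costs nothing on `V`. -/
lemma exists_smul_eq_of_mkProd_eq (hs : Function.Surjective h) {d d' : D} {v v' : V}
    (heq : mkProd h (d, v) = mkProd h (d', v')) : ∃ γ : Γ, γ • d = d' ∧ h γ • v = v' := by
  obtain ⟨g, hg⟩ := Quotient.exact (s := MulAction.orbitRel G _) heq.symm
  obtain ⟨γ, rfl⟩ := hs g
  have h1 := (hsmul γ d).symm.trans (congrArg Prod.fst hg)
  have h2 : h γ • v = v' := congrArg Prod.snd hg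
  obtain ⟨n, hn⟩ := Quotient.exact (s := MulAction.orbitRel h.ker D) h1.symm
  refine ⟨n * γ, by rw [mul_smul]; exact hn, ?_⟩
  rw [map_mul, (MonoidHom.mem_ker).1 n.2, one_mul, h2]

variable [TopologicalSpace D] [TopologicalSpace V] [ContinuousConstSMul Γ D]
  [ContinuousConstSMul G V]

lemma continuousConstSMul_kerQuotient (hs : Function.Surjective h) :
    ContinuousConstSMul G (Quotient (MulAction.orbitRel h.ker D)) := by
  refine ⟨fun g => ?_⟩
  obtain ⟨γ, rfl⟩ := hs g
  refine isQuotientMap_quotient_mk'.continuous_iff.2 ?_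
  have h1 : Continuous fun d : D => Quotient.mk (MulAction.orbitRel h.ker D) (γ • d) :=
    continuous_quotient_mk'.comp (continuous_const_smul γ)
  exact h1.congr fun d => (hsmul γ d).symm

omit hsmul [ContinuousConstSMul Γ D] [ContinuousConstSMul G V] in
lemma continuous_mkProd : Continuous (mkProd h (D := D) (V := V)) :=
  continuous_quotient_mk'.comp (continuous_quotient_mk'.prodMap continuous_id)

omit hsmul in
lemma isOpenMap_mkProd [ContinuousConstSMul G (Quotient (MulAction.orbitRel h.ker D))] :
    IsOpenMap (mkProd h (D := D) (V := V)) :=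
  haveI : ContinuousConstSMul h.ker D := ⟨fun n => continuous_const_smul (n : Γ)⟩
  isOpenMap_quotient_mk'_mul.comp (isOpenMap_quotient_mk'_mul.prodMap IsOpenMap.id)

end Quotients

/-! ### Orbifolds with a single chart and the quotient model of the projection. -/

namespace OrbifoldChart

section OfMap

variable {E : Type*} [NormedAddCommGroup E] [NormedSpace ℝ E]
  {X : Type*} [TopologicalSpace X]

open Classical in
/-- A chart given by a map defined on the subtype of its domain only. -/
noncomputable def ofSubtypeMap (dom : Set E) (ho : IsOpen dom) (hc : IsConnected dom)
    (grp : Type) [Group grp] [Finite grp] (act : grp → E → E)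
    (act_mapsTo : ∀ h, MapsTo (act h) dom dom)
    (act_one : ∀ y ∈ dom, act 1 y = y)
    (act_mul : ∀ g h, ∀ y ∈ dom, act (g * h) y = act g (act h y))
    (act_smooth : ∀ h, ContDiffOn ℝ ∞ (act h) dom)
    (act_effective : ∀ h, (∀ y ∈ dom, act h y = y) → h = 1)
    (π : dom → X) (hπ : Continuous π)
    (hact : ∀ h, ∀ y : dom, π ⟨act h y, act_mapsTo h y.2⟩ = π y)
    (hex : ∀ y z : dom, π y = π z → ∃ h, act h y = z)
    (hopen : IsOpenMap π) : OrbifoldChart E X where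
  dom := dom
  isOpen_dom := ho
  isConnected_dom := hc
  grp := grp
  act := act
  act_mapsTo := act_mapsTo
  act_one := act_one
  act_mul := act_mul
  act_smooth := act_smooth
  act_effective := act_effective
  map := fun y => if h : y ∈ dom then π ⟨y, h⟩ else π ⟨hc.nonempty.some, hc.nonempty.some_mem⟩
  map_continuousOn := by
    rw [continuousOn_iff_continuous_domRestrict]
    convert hπ using 1
    funext y
    simp
  map_act := fun h y hy => by
    rw [dif_pos hy, dif_pos (act_mapsTo h hy)]
    exact hact h ⟨y, hy⟩
  exists_act_eq := fun y hy z hz h => by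
    rw [dif_pos hy, dif_pos hz] at h
    exact hex _ _ h
  map_isOpen := fun W hW hWo => by
    convert hopen (Subtype.val ⁻¹' W) (hWo.preimage continuous_subtype_val) using 1
    ext x
    constructor
    · rintro ⟨w, hw, rfl⟩
      exact ⟨⟨w, hW hw⟩, hw, by simp [hW hw]⟩
    · rintro ⟨⟨w, hwd⟩, hw, rfl⟩
      exact ⟨w, hw, by simp [hwd]⟩

lemma ofOpen_map (W : Set E) (hW : IsOpen W) (hc : IsConnected W) {y : E} (hy : y ∈ W) :
    (ofOpen W hW hc).map y = ⟨y, hy⟩ :=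
  dif_pos hy

lemma image_ofOpen (W : Set E) (hW : IsOpen W) (hc : IsConnected W) :
    (ofOpen W hW hc).image = univ :=
  eq_univ_of_forall fun y => ⟨y, y.2, ofOpen_map W hW hc y.2⟩

instance (c : OrbifoldChart E X) : ContinuousConstSMul c.grp c.dom :=
  ⟨fun g => (c.act_smooth g).continuousOn.mapsToRestrict (c.act_mapsTo g)⟩

end OfMap

end OrbifoldChart

/-- The orbifold given by a single chart. -/
def Orbifold.ofChart {E : Type*} [NormedAddCommGroup E] [NormedSpace ℝ E]
    {X : Type*} [TopologicalSpace X] (c : OrbifoldChart E X) (hc : c.image = univ)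
    (h2 : T2Space X) (hp : ParacompactSpace X) : Orbifold E X where
  atlas := {c}
  covers := fun x => ⟨c, rfl, hc ▸ mem_univ x⟩
  compatible := by
    rintro _ rfl _ rfl
    exact .refl _
  t2 := h2
  paracompact := hp

lemma Orbifold.isChart_ofChart {E : Type*} [NormedAddCommGroup E] [NormedSpace ℝ E]
    {X : Type*} [TopologicalSpace X] (c : OrbifoldChart E X) (hc : c.image = univ)
    (h2 : T2Space X) (hp : ParacompactSpace X) : (Orbifold.ofChart c hc h2 hp).IsChart c := by
  intro d hd
  rw [show d = c from hd]
  exact ⟨.refl _, .refl _⟩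

/-- A map that, between a chart of the source and a chart of the target, is the projection
`D × V → V`, equivariant with respect to a surjective homomorphism of the chart groups, is locally
the projection of a bundle of orbifolds. -/
theorem exists_bundle_of_equivariant_product {n m k : ℕ}
    {X : Type*} [TopologicalSpace X] {Y : Type*} [TopologicalSpace Y]
    (O : Orbifold (EuclideanSpace ℝ (Fin n)) X) (P : Orbifold (EuclideanSpace ℝ (Fin m)) Y)
    (f : X → Y) (x : X)
    (b : OrbifoldChart (EuclideanSpace ℝ (Fin n)) X) (hb : O.IsChart b) (hxb : x ∈ b.image)
    (c : OrbifoldChart (EuclideanSpace ℝ (Fin m)) Y) (hc : P.IsChart c) (hcx : c.IsAround (f x))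
    (h : b.grp →* c.grp) (hs : Function.Surjective h)
    (D : Set (EuclideanSpace ℝ (Fin k))) (hDo : IsOpen D) (hDc : IsConnected D)
    (a : b.grp → EuclideanSpace ℝ (Fin k) → EuclideanSpace ℝ (Fin k))
    (ha : ∀ g, MapsTo (a g) D D) (ha1 : ∀ y ∈ D, a 1 y = y)
    (ham : ∀ g g', ∀ y ∈ D, a (g * g') y = a g (a g' y))
    (has : ∀ g, ContDiffOn ℝ ∞ (a g) D)
    (l : EuclideanSpace ℝ (Fin n) → EuclideanSpace ℝ (Fin k) × EuclideanSpace ℝ (Fin m))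
    (l' : EuclideanSpace ℝ (Fin k) × EuclideanSpace ℝ (Fin m) → EuclideanSpace ℝ (Fin n))
    (hl : MapsTo l b.dom (D ×ˢ c.dom)) (hl' : MapsTo l' (D ×ˢ c.dom) b.dom)
    (hls : ContDiffOn ℝ ∞ l b.dom) (hls' : ContDiffOn ℝ ∞ l' (D ×ˢ c.dom))
    (hinv : InvOn l' l b.dom (D ×ˢ c.dom))
    (heq : ∀ g, ∀ y ∈ b.dom, l (b.act g y) = (a g (l y).1, c.act (h g) (l y).2))
    (hcomm : ∀ y ∈ b.dom, c.map (l y).2 = f (b.map y)) :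
    ∃ (k : ℕ) (F : Type) (_ : TopologicalSpace F) (𝓕 : Orbifold (EuclideanSpace ℝ (Fin k)) F)
      (c : OrbifoldChart (EuclideanSpace ℝ (Fin m)) Y) (_ : MulAction c.grp F)
      (Q : Orbifold (EuclideanSpace ℝ (Fin k) × EuclideanSpace ℝ (Fin m))
        (Quotient (MulAction.orbitRel c.grp (F × c.dom))))
      (B : Orbifold (EuclideanSpace ℝ (Fin m)) (Quotient (MulAction.orbitRel c.grp c.dom)))
      (U : Set X) (Θ : X → Quotient (MulAction.orbitRel c.grp (F × c.dom))),
      P.IsChart c ∧ c.IsAround (f x) ∧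
      𝓕.IsSmoothAction c.grp ∧
      (𝓕.prod (.ofOpen c.dom c.isOpen_dom c.isConnected_dom)).IsQuotient c.grp
        Q.toOrbifoldStructure ∧
      (OrbifoldStructure.ofOpen c.dom c.isOpen_dom c.isConnected_dom).IsQuotient c.grp
        B.toOrbifoldStructure ∧
      x ∈ U ∧
      O.IsDiffeoOn Q.toOrbifoldStructure U univ Θ ∧
      B.IsDiffeoOn P.toOrbifoldStructure univ c.image c.orbitMap ∧
      ∀ y ∈ U, f y = c.orbitMap (orbitProj c.grp F c.dom (Θ y)) := by
  classical
  let instD : MulAction b.grp D :=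
    { smul := fun g d => ⟨a g d, ha g d.2⟩
      one_smul := fun d => Subtype.ext (ha1 d d.2)
      mul_smul := fun g g' d => Subtype.ext (ham g g' d d.2) }
  have contD : ContinuousConstSMul b.grp D :=
    ⟨fun g => (has g).continuousOn.mapsToRestrict (ha g)⟩
  have contD' : ContinuousConstSMul h.ker D := ⟨fun n => continuous_const_smul (n : b.grp)⟩
  let F : Type := Quotient (MulAction.orbitRel h.ker D)
  let instF : MulAction c.grp F := kerQuotientAction h D hs
  have hsmul : ∀ (γ : b.grp) (d : D), h γ • (Quotient.mk (MulAction.orbitRel h.ker D) d) =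
      Quotient.mk (MulAction.orbitRel h.ker D) (γ • d) := kerQuotientAction_smul_mk h hs
  have contF : ContinuousConstSMul c.grp F := continuousConstSMul_kerQuotient h hsmul hs
  have : LocallyCompactSpace D := hDo.locallyCompactSpace
  have : LocallyCompactSpace c.dom := c.isOpen_dom.locallyCompactSpace
  obtain ⟨t2F, lcF, scF, pcF⟩ := t2Space_and_paracompactSpace_quotient h.ker D
  obtain ⟨t2B, -, -, pcB⟩ := t2Space_and_paracompactSpace_quotient c.grp c.dom
  obtain ⟨t2Q, -, -, pcQ⟩ := t2Space_and_paracompactSpace_quotient c.grp (F × c.dom)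
  -- the charts
  let cF : OrbifoldChart (EuclideanSpace ℝ (Fin k)) F :=
    .ofSubtypeMap D hDo hDc h.ker (fun n => a n) (fun n => ha n) ha1 (fun n n' => ham n n')
      (fun n => has n)
      (by
        -- A kernel element acts trivially on `c.dom`. If it is also trivial on `D`, injectivity of
        -- `l` makes it trivial on `b.dom`, where the group is effective.
        rintro ⟨n, hn⟩ hfix
        refine Subtype.ext (b.act_effective n fun y hy => ?_)
        have h1 := heq n y hy
        rw [hfix _ (hl hy).1, (MonoidHom.mem_ker).1 hn, c.act_one _ (hl hy).2] at h1
        rw [← hinv.1 (b.act_mapsTo n hy), h1]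
        exact hinv.1 hy)
      (Quotient.mk _) continuous_quotient_mk'
      (fun n y => Quotient.sound (s := MulAction.orbitRel h.ker D) ⟨n, rfl⟩)
      (fun y z hyz => by
        obtain ⟨n, hn⟩ := Quotient.exact (s := MulAction.orbitRel h.ker D) hyz.symm
        exact ⟨n, congrArg Subtype.val hn⟩)
      isOpenMap_quotient_mk'_mul
  have hcFmap : ∀ d (hd : d ∈ D), cF.map d = Quotient.mk _ ⟨d, hd⟩ := fun d hd => dif_pos hd
  have hcFimage : cF.image = univ := eq_univ_of_forall <| by
    rintro ⟨d⟩
    exact ⟨d, d.2, hcFmap d d.2⟩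
  let cB : OrbifoldChart (EuclideanSpace ℝ (Fin m))
      (Quotient (MulAction.orbitRel c.grp c.dom)) :=
    .ofSubtypeMap c.dom c.isOpen_dom c.isConnected_dom c.grp c.act c.act_mapsTo c.act_one
      c.act_mul c.act_smooth c.act_effective (Quotient.mk _) continuous_quotient_mk'
      (fun n y => Quotient.sound (s := MulAction.orbitRel c.grp c.dom) ⟨n, rfl⟩)
      (fun y z hyz => by
        obtain ⟨n, hn⟩ := Quotient.exact (s := MulAction.orbitRel c.grp c.dom) hyz.symm
        exact ⟨n, congrArg Subtype.val hn⟩)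
      isOpenMap_quotient_mk'_mul
  have hcBmap : ∀ d (hd : d ∈ c.dom), cB.map d = Quotient.mk _ ⟨d, hd⟩ := fun d hd => dif_pos hd
  have hcBimage : cB.image = univ := eq_univ_of_forall <| by
    rintro ⟨d⟩
    exact ⟨d, d.2, hcBmap d d.2⟩
  let e : (D ×ˢ c.dom : Set _) ≃ₜ D × c.dom := Homeomorph.Set.prod D c.dom
  -- The two-stage quotient is uniformized by `D ×ˢ c.dom` with the full group `b.grp`, which is
  -- what allows `l` to lift the diffeomorphism with the identity on groups.
  let cQ : OrbifoldChart (EuclideanSpace ℝ (Fin k) × EuclideanSpace ℝ (Fin m))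
      (Quotient (MulAction.orbitRel c.grp (F × c.dom))) :=
    .ofSubtypeMap (D ×ˢ c.dom) (hDo.prod c.isOpen_dom) (hDc.prod c.isConnected_dom) b.grp
      (fun g => Prod.map (a g) (c.act (h g)))
      (fun g y hy => ⟨ha g hy.1, c.act_mapsTo _ hy.2⟩)
      (fun y hy => Prod.ext (ha1 _ hy.1) (by rw [map_one]; exact c.act_one _ hy.2))
      (fun g g' y hy => Prod.ext (ham _ _ _ hy.1) (by rw [map_mul]; exact c.act_mul _ _ _ hy.2))
      (fun g => (has g).prodMap (c.act_smooth _))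
      (fun g hfix => by
        refine b.act_effective g fun y hy => ?_
        have h1 : l (b.act g y) = l y := (heq g y hy).trans (hfix _ (hl hy))
        rw [← hinv.1 (b.act_mapsTo g hy), h1]
        exact hinv.1 hy)
      (mkProd h ∘ e) ((continuous_mkProd h).comp e.continuous)
      (fun g y => mkProd_smul h hsmul g (e y).1 (e y).2)
      (fun y z hyz => by
        obtain ⟨g, hg, hg'⟩ := exists_smul_eq_of_mkProd_eq h hsmul hs hyz
        exact ⟨g, Prod.ext (congrArg Subtype.val hg) (congrArg Subtype.val hg')⟩)
      ((isOpenMap_mkProd h).comp e.isOpenMap)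
  have hcQmap : ∀ p (hp : p ∈ D ×ˢ c.dom), cQ.map p = mkProd h (⟨p.1, hp.1⟩, ⟨p.2, hp.2⟩) :=
    fun p hp => dif_pos hp
  have hcQimage : cQ.image = univ := eq_univ_of_forall fun q => by
    obtain ⟨p, rfl⟩ := mkProd_surjective h q
    exact ⟨(p.1, p.2), ⟨p.1.2, p.2.2⟩, hcQmap (p.1, p.2) ⟨p.1.2, p.2.2⟩⟩
  let 𝓕 : Orbifold (EuclideanSpace ℝ (Fin k)) F := .ofChart cF hcFimage t2F pcF
  let B := Orbifold.ofChart cB hcBimage t2B pcB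
  let Q := Orbifold.ofChart cQ hcQimage t2Q pcQ
  have h𝓕 : 𝓕.IsChart cF := Orbifold.isChart_ofChart _ _ _ _
  have hB : B.IsChart cB := Orbifold.isChart_ofChart _ _ _ _
  have hQ : Q.IsChart cQ := Orbifold.isChart_ofChart _ _ _ _
  let cV := OrbifoldChart.ofOpen c.dom c.isOpen_dom c.isConnected_dom
  have hcVmap : ∀ v (hv : v ∈ c.dom), cV.map v = ⟨v, hv⟩ := fun v hv =>
    OrbifoldChart.ofOpen_map _ _ _ hv
  have hV : (OrbifoldStructure.ofOpen c.dom c.isOpen_dom c.isConnected_dom).IsChart cV := by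
    rintro d hd
    rw [show d = cV from hd]
    exact ⟨.refl _, .refl _⟩
  have hFV : (𝓕.prod (.ofOpen c.dom c.isOpen_dom c.isConnected_dom)).IsChart (cF.prod cV) := by
    rintro _ ⟨d, hd, d', hd', rfl⟩
    rw [show d = cF from hd, show d' = cV from hd']
    exact ⟨.refl _, .refl _⟩
  have hFVimage : (cF.prod cV).image = univ := by
    rw [OrbifoldChart.image_prod, hcFimage, OrbifoldChart.image_ofOpen, univ_prod_univ]
  -- the actions are smooth
  have hFact : ∀ (γ : b.grp), ∀ d ∈ D, cF.map (a γ d) = h γ • cF.map d := fun γ d hd => by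
    rw [hcFmap _ (ha γ hd), hcFmap d hd, hsmul γ]
    rfl
  have hVact : ∀ (g : c.grp), ∀ v ∈ c.dom, cV.map (c.act g v) = g • cV.map v := fun g v hv => by
    rw [hcVmap _ (c.act_mapsTo g hv), hcVmap v hv]
    rfl
  -- The lift `a γ` of the action of `h γ` on `F` does not commute with the kernel; it is
  -- equivariant for conjugation by `γ`, which preserves `ker h`.
  have hconj : ∀ (γ : b.grp) (n : h.ker), ∀ d ∈ D,
      a γ (a n d) = a ((MulAut.conjNormal γ n : h.ker) : b.grp) (a γ d) := fun γ n d hd => by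
    rw [← ham _ _ _ hd, ← ham _ _ _ hd, MulAut.conjNormal_apply]
    group
  have smoothF : 𝓕.IsSmoothAction c.grp := by
    intro g
    obtain ⟨γ, rfl⟩ := hs g
    refine OrbifoldStructure.IsSmoothOn.isSmooth (V := cF.image) ?_
    rw [← hcFimage]
    exact OrbifoldStructure.isSmoothOn_of_lift h𝓕 h𝓕
      (MulAut.conjNormal γ : h.ker ≃* h.ker).toMonoidHom (a γ) (ha γ) (has γ) (hconj γ) (hFact γ)
  have smoothV : (OrbifoldStructure.ofOpen c.dom c.isOpen_dom
      c.isConnected_dom).IsSmoothAction c.grp := by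
    intro g
    refine OrbifoldStructure.IsSmoothOn.isSmooth (V := cV.image) ?_
    rw [← OrbifoldChart.image_ofOpen c.dom c.isOpen_dom c.isConnected_dom]
    exact OrbifoldStructure.isSmoothOn_of_lift hV hV (MonoidHom.id _) (c.act g) (c.act_mapsTo g)
      (c.act_smooth g) (fun _ _ _ => rfl) (hVact g)
  have smoothFV : (𝓕.prod (.ofOpen c.dom c.isOpen_dom
      c.isConnected_dom)).IsSmoothAction c.grp := by
    intro g
    obtain ⟨γ, rfl⟩ := hs g
    refine OrbifoldStructure.IsSmoothOn.isSmooth (V := (cF.prod cV).image) ?_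
    rw [← hFVimage]
    exact OrbifoldStructure.isSmoothOn_of_lift hFV hFV
      ((MulAut.conjNormal γ : h.ker ≃* h.ker).toMonoidHom.prodMap (MonoidHom.id _))
      (Prod.map (a γ) (c.act (h γ))) (fun p hp => ⟨ha γ hp.1, c.act_mapsTo _ hp.2⟩)
      ((has γ).prodMap (c.act_smooth _)) (fun n p hp => Prod.ext (hconj γ n.1 _ hp.1) rfl)
      (fun p hp => Prod.ext (hFact γ _ hp.1) (hVact _ _ hp.2))
  -- the diffeomorphism
  let Θ : X → Quotient (MulAction.orbitRel c.grp (F × c.dom)) := fun y =>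
    if hy : y ∈ b.image then cQ.map (l hy.choose) else cQ.map (l hxb.choose)
  have hΘ : ∀ y ∈ b.dom, cQ.map (l y) = Θ (b.map y) := by
    intro y hy
    have hy' : b.map y ∈ b.image := ⟨y, hy, rfl⟩
    simp only [Θ, dif_pos hy']
    obtain ⟨g, hg⟩ := b.exists_act_eq _ hy'.choose_spec.1 y hy hy'.choose_spec.2
    conv_lhs => rw [← hg, heq g _ hy'.choose_spec.1]
    exact cQ.map_act g _ (hl hy'.choose_spec.1)
  refine ⟨k, F, inferInstance, 𝓕, c, instF, Q, B, b.image, Θ, hc, hcx, smoothF, ⟨smoothFV, ?_⟩,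
    ⟨smoothV, ?_⟩, hxb, ?_, ?_, ?_⟩
  -- One pair of charts serves all points: `cQ` has the domain of `cF.prod cV`, and `γ` in its group
  -- lifts `h γ`.
  · intro p
    refine ⟨cF.prod cV, hFV, hFVimage ▸ mem_univ p, cQ, hQ, rfl, fun y hy => ?_, fun γ =>
      ⟨h γ, fun y hy => Prod.ext (hFact γ _ hy.1) (hVact _ _ hy.2)⟩⟩
    rw [hcQmap y hy]
    change _ = Quotient.mk _ (cF.map y.1, cV.map y.2)
    rw [hcFmap _ hy.1, hcVmap _ hy.2]
    rfl
  · intro v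
    refine ⟨cV, hV, (OrbifoldChart.image_ofOpen c.dom c.isOpen_dom c.isConnected_dom) ▸ mem_univ v,
      cB, hB, rfl, fun y hy => ?_, fun g => ⟨g, fun y hy => hVact g y hy⟩⟩
    rw [hcBmap y hy, hcVmap y hy]
  · rw [← hcQimage]
    exact OrbifoldStructure.isDiffeoOn_of_lift hb hQ (MulEquiv.refl _) l l' hl hl' hls hls' hinv
      heq hΘ
  · rw [← hcBimage]
    refine OrbifoldStructure.isDiffeoOn_of_lift hB hc (MulEquiv.refl _) id id (mapsTo_id _)
      (mapsTo_id _) contDiffOn_id contDiffOn_id ⟨fun _ _ => rfl, fun _ _ => rfl⟩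
      (fun _ _ _ => rfl) (fun y hy => ?_)
    rw [hcBmap y hy]
    rfl
  · rintro _ ⟨y, hy, rfl⟩
    rw [← hΘ y hy, hcQmap _ (hl hy), ← hcomm y hy]
    rfl

/-! ### Normal form of equivariant submersions near a fixed point. -/

/-- Small connected open neighborhoods of `0` that are invariant under a linear action of a finite
group. -/
lemma exists_isOpen_isConnected_mapsTo {G F : Type*} [Group G] [Finite G] [NormedAddCommGroup F]
    [NormedSpace ℝ F] (a : G → F →L[ℝ] F) (ha1 : ∀ v, a 1 v = v)
    (ham : ∀ g g' v, a (g * g') v = a g (a g' v)) {u : Set F} (hu : u ∈ 𝓝 0) :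
    ∃ D, IsOpen D ∧ IsConnected D ∧ D ⊆ u ∧ 0 ∈ D ∧ ∀ g, MapsTo (a g) D D := by
  obtain ⟨r, hr, hru⟩ := Metric.mem_nhds_iff.1 hu
  have hmem : ∀ w, w ∈ (⋂ g, a g ⁻¹' Metric.ball 0 r) ↔ ∀ g, a g w ∈ Metric.ball (0 : F) r :=
    fun w => mem_iInter
  have h0 : (0 : F) ∈ ⋂ g, a g ⁻¹' Metric.ball 0 r := (hmem 0).2 fun g => by simpa using hr
  -- Linear preimages of a ball are convex, so their intersection is convex and hence connected; no
  -- passage to a component is needed.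
  refine ⟨⋂ g, a g ⁻¹' Metric.ball 0 r, isOpen_iInter_of_finite fun g =>
    Metric.isOpen_ball.preimage (a g).continuous, ⟨⟨0, h0⟩, ?_⟩, fun w hw => hru ?_, h0,
    fun g w hw => (hmem _).2 fun g' => ?_⟩
  · exact (convex_iInter fun g => (convex_ball (0 : F) r).linear_preimage
      (a g : F →ₗ[ℝ] F)).isPreconnected
  · rw [← ha1 w]
    exact (hmem w).1 hw 1
  · rw [← ham]
    exact (hmem w).1 hw (g' * g)

namespace OrbifoldChart

variable {E : Type*} [NormedAddCommGroup E] [NormedSpace ℝ E]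
  {E' : Type*} [NormedAddCommGroup E'] [NormedSpace ℝ E']
  {X : Type*} [TopologicalSpace X] {Y : Type*} [TopologicalSpace Y]

lemma fderiv_act_mul (c : OrbifoldChart E X) {y : E} (hy : y ∈ c.dom)
    (hfix : ∀ g, c.act g y = y) (g g' : c.grp) :
    fderiv ℝ (c.act (g * g')) y = (fderiv ℝ (c.act g) y).comp (fderiv ℝ (c.act g') y) := by
  have h1 : ∀ g, DifferentiableAt ℝ (c.act g) y := fun g =>
    (c.contDiffAt_act g hy).differentiableAt (by simp)
  have h2 : c.act (g * g') =ᶠ[𝓝 y] c.act g ∘ c.act g' := by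
    filter_upwards [c.isOpen_dom.mem_nhds hy] with z hz using c.act_mul g g' z hz
  rw [h2.fderiv_eq, fderiv_comp y (by rw [hfix]; exact h1 g) (h1 g'), hfix]

lemma fderiv_act_one (c : OrbifoldChart E X) {y : E} (hy : y ∈ c.dom) :
    fderiv ℝ (c.act 1) y = ContinuousLinearMap.id ℝ E := by
  have h2 : c.act 1 =ᶠ[𝓝 y] id := by
    filter_upwards [c.isOpen_dom.mem_nhds hy] with z hz using c.act_one z hz
  rw [h2.fderiv_eq, fderiv_id]

variable [FiniteDimensional ℝ E] [FiniteDimensional ℝ E']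

/-- Near a fixed point, an equivariant submersion extends, by a map that is equivariant with respect
to a linear action, to a local coordinate system. -/
lemma exists_equivariant_complement (c : OrbifoldChart E X) (d : OrbifoldChart E' Y)
    (h : c.grp →* d.grp) (l : E → E') (hl : MapsTo l c.dom d.dom) (hls : ContDiffOn ℝ ∞ l c.dom)
    (heq : ∀ g, ∀ z ∈ c.dom, l (c.act g z) = d.act (h g) (l z)) {y : E} (hy : y ∈ c.dom)
    (hfix : ∀ g, c.act g y = y) (hsurj : Function.Surjective (fderiv ℝ l y)) :
    ∃ (k : ℕ) (a : c.grp → EuclideanSpace ℝ (Fin k) →L[ℝ] EuclideanSpace ℝ (Fin k))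
      (p : E → EuclideanSpace ℝ (Fin k)) (e : E ≃L[ℝ] EuclideanSpace ℝ (Fin k) × E'),
      (∀ v, a 1 v = v) ∧ (∀ g g' v, a (g * g') v = a g (a g' v)) ∧
      ContDiffOn ℝ ∞ p c.dom ∧ (∀ g, ∀ z ∈ c.dom, p (c.act g z) = a g (p z)) ∧ p y = 0 ∧
      HasFDerivAt (fun z => (p z, l z)) (e : E →L[ℝ] EuclideanSpace ℝ (Fin k) × E') y := by
  classical
  have := Fintype.ofFinite c.grp
  let A : c.grp → E →L[ℝ] E := fun g => fderiv ℝ (c.act g) y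
  have hA : ∀ g, HasFDerivAt (c.act g) (A g) y := fun g =>
    ((c.contDiffAt_act g hy).differentiableAt (by simp)).hasFDerivAt
  let L : E →L[ℝ] E' := fderiv ℝ l y
  have hL : HasFDerivAt l L y :=
    ((hls.contDiffAt (c.isOpen_dom.mem_nhds hy)).differentiableAt (by simp)).hasFDerivAt
  -- Differentiating the equivariance of `l` at the fixed point shows that the kernel of `L` is a
  -- subrepresentation.
  have hker : ∀ g v, L v = 0 → L (A g v) = 0 := by
    intro g v hv
    have h1 : HasFDerivAt (l ∘ c.act g) (L.comp (A g)) y :=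
      HasFDerivAt.comp y (by rw [hfix]; exact hL) (hA g)
    have h2 : HasFDerivAt (d.act (h g) ∘ l) ((fderiv ℝ (d.act (h g)) (l y)).comp L) y :=
      HasFDerivAt.comp y
        ((d.contDiffAt_act (h g) (hl hy)).differentiableAt (by simp)).hasFDerivAt hL
    have h3 : l ∘ c.act g =ᶠ[𝓝 y] d.act (h g) ∘ l := by
      filter_upwards [c.isOpen_dom.mem_nhds hy] with z hz using heq g z hz
    have h4 := congrArg (fun T => T v) (h1.unique (h2.congr_of_eventuallyEq h3))
    simpa [hv] using h4
  let k := Module.finrank ℝ (LinearMap.ker (L : E →ₗ[ℝ] E'))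
  let κ : EuclideanSpace ℝ (Fin k) ≃ₗ[ℝ] LinearMap.ker (L : E →ₗ[ℝ] E') :=
    LinearEquiv.ofFinrankEq _ _ (by simp [k])
  let ι : EuclideanSpace ℝ (Fin k) →ₗ[ℝ] E := (LinearMap.ker (L : E →ₗ[ℝ] E')).subtype ∘ₗ κ
  have hι : Function.Injective ι := Subtype.val_injective.comp κ.injective
  have hιL : ∀ v, L (ι v) = 0 := fun v => (κ v).2
  obtain ⟨q, hq⟩ := LinearMap.exists_leftInverse_of_injective ι (LinearMap.ker_eq_bot.2 hι)
  have hqι : ∀ v, q (ι v) = v := fun v => LinearMap.congr_fun hq v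
  have hιq : ∀ v, L v = 0 → ι (q v) = v := by
    intro v hv
    obtain ⟨w, hw⟩ := κ.surjective ⟨v, hv⟩
    have : ι w = v := congrArg Subtype.val hw
    rw [← this, hqι]
  let q' : E →L[ℝ] EuclideanSpace ℝ (Fin k) := LinearMap.toContinuousLinearMap q
  -- The representation on the kernel of `L`, transported to `ℝᵏ` by `ι` and its left inverse `q`.
  let a : c.grp → EuclideanSpace ℝ (Fin k) →L[ℝ] EuclideanSpace ℝ (Fin k) := fun g =>
    q'.comp ((A g).comp (LinearMap.toContinuousLinearMap ι))
  have ha : ∀ g v, a g v = q (A g (ι v)) := fun g v => rfl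
  have ha1 : ∀ v, a 1 v = v := fun v => by
    rw [ha, show A 1 = _ from c.fderiv_act_one hy]
    exact hqι v
  have ham : ∀ g g' v, a (g * g') v = a g (a g' v) := fun g g' v => by
    rw [ha, ha, ha, hιq _ (hker g' _ (hιL v)), show A (g * g') = _ from c.fderiv_act_mul hy hfix g g']
    rfl
  -- The average, without normalization, of the projection `q'` centered at `y`. On the kernel of
  -- `L` its derivative is the group order times the identity, so `(p, l)` has injective derivative,
  -- and bijective by dimension.
  let p : E → EuclideanSpace ℝ (Fin k) := fun z => ∑ g, a g⁻¹ (q' (c.act g z - y))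
  let p' : E →L[ℝ] EuclideanSpace ℝ (Fin k) := ∑ g, ((a g⁻¹).comp q').comp (A g)
  have hp' : HasFDerivAt p p' y := HasFDerivAt.fun_sum fun g _ =>
    ((a g⁻¹).comp q').hasFDerivAt.comp y ((hA g).sub_const y)
  have hp'ι : ∀ v, p' (ι v) = (Fintype.card c.grp : ℝ) • v := by
    intro v
    have h1 : ∀ g, a g⁻¹ (q' (A g (ι v))) = v := fun g => by
      change a g⁻¹ (a g v) = v
      rw [← ham, inv_mul_cancel, ha1]
    simp [p', h1, Nat.cast_smul_eq_nsmul]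
  have hinj : Function.Injective (p'.prod L) := by
    rw [injective_iff_map_eq_zero]
    intro v hv
    have hv2 : L v = 0 := congrArg Prod.snd hv
    have hv1 : p' v = 0 := congrArg Prod.fst hv
    rw [← hιq v hv2, hp'ι, smul_eq_zero] at hv1
    rw [← hιq v hv2, hv1.resolve_left (by exact_mod_cast Fintype.card_ne_zero), map_zero]
  have hrank : Module.finrank ℝ E = Module.finrank ℝ (EuclideanSpace ℝ (Fin k) × E') := by
    have h1 := LinearMap.finrank_range_add_finrank_ker (L : E →ₗ[ℝ] E')
    rw [LinearMap.range_eq_top.2 hsurj, finrank_top] at h1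
    rw [Module.finrank_prod, finrank_euclideanSpace_fin, ← h1, add_comm]
  let e : E ≃L[ℝ] EuclideanSpace ℝ (Fin k) × E' :=
    (LinearEquiv.ofBijective ((p'.prod L : E →L[ℝ] _) : E →ₗ[ℝ] _) ⟨hinj,
      (LinearMap.injective_iff_surjective_of_finrank_eq_finrank hrank).1 hinj⟩
      ).toContinuousLinearEquiv
  refine ⟨k, a, p, e, ha1, ham, ?_, ?_, ?_, ?_⟩
  · exact ContDiffOn.sum fun g _ => (a g⁻¹).contDiff.comp_contDiffOn
      (q'.contDiff.comp_contDiffOn ((c.act_smooth g).sub contDiffOn_const))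
  · intro g z hz
    simp only [p, map_sum]
    refine Fintype.sum_equiv (Equiv.mulRight g) _ _ fun g' => ?_
    rw [Equiv.coe_mulRight, mul_inv_rev, ← ham, c.act_mul _ _ z hz, mul_inv_cancel_left]
  · simp [p, hfix]
  · exact hp'.prodMk hL

/-- Near a fixed point, an equivariant submersion is equivariantly diffeomorphic to a projection
`D × V → V`. -/
theorem exists_equivariant_product (c : OrbifoldChart E X) (d : OrbifoldChart E' Y)
    (h : c.grp →* d.grp) (l : E → E') (hl : MapsTo l c.dom d.dom) (hls : ContDiffOn ℝ ∞ l c.dom)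
    (heq : ∀ g, ∀ z ∈ c.dom, l (c.act g z) = d.act (h g) (l z)) {y : E} (hy : y ∈ c.dom)
    (hfix : ∀ g, c.act g y = y) (hfix' : ∀ g, d.act g (l y) = l y)
    (hsurj : Function.Surjective (fderiv ℝ l y)) :
    ∃ (k : ℕ) (a : c.grp → EuclideanSpace ℝ (Fin k) →L[ℝ] EuclideanSpace ℝ (Fin k))
      (p : E → EuclideanSpace ℝ (Fin k)) (s : EuclideanSpace ℝ (Fin k) × E' → E)
      (D : Set (EuclideanSpace ℝ (Fin k))) (V : Set E') (W : Set E),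
      (∀ v, a 1 v = v) ∧ (∀ g g' v, a (g * g') v = a g (a g' v)) ∧
      IsOpen D ∧ IsConnected D ∧ (∀ g, MapsTo (a g) D D) ∧
      IsOpen V ∧ IsConnected V ∧ V ⊆ d.dom ∧ (∀ g, MapsTo (d.act g) V V) ∧ l y ∈ V ∧
      IsOpen W ∧ IsConnected W ∧ W ⊆ c.dom ∧ (∀ g, MapsTo (c.act g) W W) ∧ y ∈ W ∧
      MapsTo (fun z => (p z, l z)) W (D ×ˢ V) ∧ MapsTo s (D ×ˢ V) W ∧
      InvOn s (fun z => (p z, l z)) W (D ×ˢ V) ∧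
      ContDiffOn ℝ ∞ p W ∧ ContDiffOn ℝ ∞ s (D ×ˢ V) ∧
      (∀ g, ∀ z ∈ W, p (c.act g z) = a g (p z)) := by
  have := FiniteDimensional.complete ℝ E
  obtain ⟨k, a, p, e, ha1, ham, hps, hpeq, hpy, hd⟩ :=
    c.exists_equivariant_complement d h l hl hls heq hy hfix hsurj
  let Φ : E → EuclideanSpace ℝ (Fin k) × E' := fun z => (p z, l z)
  have hΦs : ContDiffOn ℝ ∞ Φ c.dom := hps.prodMk hls
  have hΦy : ContDiffAt ℝ ∞ Φ y := hΦs.contDiffAt (c.isOpen_dom.mem_nhds hy)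
  obtain ⟨φ, hφ, hyφ⟩ : ∃ φ : OpenPartialHomeomorph E (EuclideanSpace ℝ (Fin k) × E'),
      ⇑φ = Φ ∧ y ∈ φ.source :=
    ⟨hΦy.toOpenPartialHomeomorph Φ hd (by simp), hΦy.toOpenPartialHomeomorph_coe hd (by simp),
      hΦy.mem_toOpenPartialHomeomorph_source hd (by simp)⟩
  have hsrc : φ.source ∈ 𝓝 y := φ.open_source.mem_nhds hyφ
  -- Smoothness of the inverse on all of `D ×ˢ V` requires an invertible derivative at every nearby
  -- point. Invertibility is an open condition and the derivative is continuous.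
  have hequiv : ∀ᶠ z in 𝓝 y, ∃ e' : E ≃L[ℝ] EuclideanSpace ℝ (Fin k) × E',
      (e' : E →L[ℝ] EuclideanSpace ℝ (Fin k) × E') = fderiv ℝ Φ z := by
    have h0 : ContinuousAt (fderiv ℝ Φ) y :=
      (hΦs.continuousOn_fderiv_of_isOpen c.isOpen_dom (by simp)).continuousAt
        (c.isOpen_dom.mem_nhds hy)
    have h1 : range (fun e' : E ≃L[ℝ] EuclideanSpace ℝ (Fin k) × E' =>
        (e' : E →L[ℝ] EuclideanSpace ℝ (Fin k) × E')) ∈ 𝓝 (fderiv ℝ Φ y) := by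
      rw [hd.fderiv]
      exact e.nhds
    filter_upwards [h0.preimage_mem_nhds h1] with z hz using hz
  obtain ⟨S, hSo, -, hSd, hST, hyS, hSm, -⟩ := c.exists_slice hy (Filter.inter_mem hsrc hequiv)
  have hSsrc : S ⊆ φ.source := fun z hz => (hST hz).1
  have himg : Φ '' S ∈ 𝓝 ((0 : EuclideanSpace ℝ (Fin k)), l y) := by
    have h1 : IsOpen (φ '' S) := φ.isOpen_image_of_subset_source hSo hSsrc
    rw [hφ] at h1
    exact h1.mem_nhds ⟨y, hyS, Prod.ext hpy rfl⟩
  rw [mem_nhds_prod_iff] at himg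
  obtain ⟨u, hu, v, hv, huv⟩ := himg
  obtain ⟨D, hDo, hDc, hDu, hD0, hDm⟩ := exists_isOpen_isConnected_mapsTo a ha1 ham hu
  obtain ⟨V, hVo, hVc, hVd, hVv, hyV, hVm, -⟩ := d.exists_slice (hl hy) hv
  have hDV : D ×ˢ V ⊆ Φ '' S := (prod_mono hDu hVv).trans huv
  have hsymm : ∀ q ∈ D ×ˢ V, φ.symm q ∈ S ∧ Φ (φ.symm q) = q := by
    intro q hq
    obtain ⟨z, hz, rfl⟩ := hDV hq
    have h1 : φ.symm (Φ z) = z := by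
      rw [← hφ]
      exact φ.left_inv (hSsrc hz)
    rw [h1]
    exact ⟨hz, rfl⟩
  have hss : ContDiffOn ℝ ∞ φ.symm (D ×ˢ V) := by
    intro q hq
    obtain ⟨hqS, hq'⟩ := hsymm q hq
    obtain ⟨e', he'⟩ := (hST hqS).2
    have h1 := hΦs.contDiffAt (c.isOpen_dom.mem_nhds (hSd hqS))
    refine (φ.contDiffAt_symm (f₀' := e') ?_ ?_ (by rwa [hφ])).contDiffWithinAt
    · rw [← hq', ← hφ]
      exact φ.map_source (hSsrc hqS)
    · rw [he', hφ]
      exact (h1.differentiableAt (by simp)).hasFDerivAt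
  -- `S` and `D ×ˢ V` are invariant, hence so is `W`. It is connected as the image of `D ×ˢ V` under
  -- the inverse.
  let W : Set E := S ∩ Φ ⁻¹' (D ×ˢ V)
  have hsW : MapsTo φ.symm (D ×ˢ V) W := fun q hq =>
    ⟨(hsymm q hq).1, by rw [mem_preimage, (hsymm q hq).2]; exact hq⟩
  have hinv : InvOn φ.symm Φ W (D ×ˢ V) :=
    ⟨fun z hz => by rw [← hφ]; exact φ.left_inv (hSsrc hz.1), fun q hq => (hsymm q hq).2⟩
  refine ⟨k, a, p, φ.symm, D, V, W, ha1, ham, hDo, hDc, hDm, hVo, hVc, hVd,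
    fun g => hVm g (hfix' g), hyV, (hΦs.mono hSd).continuousOn.isOpen_inter_preimage hSo
    (hDo.prod hVo), ?_, inter_subset_left.trans hSd, ?_, ⟨hyS, ?_⟩, fun z hz => hz.2, hsW, hinv,
    hps.mono (inter_subset_left.trans hSd), hss, fun g z hz => hpeq g z (hSd hz.1)⟩
  · have h1 : W = φ.symm '' (D ×ˢ V) :=
      Subset.antisymm (fun z hz => ⟨Φ z, hz.2, hinv.1 hz⟩) hsW.image_subset
    rw [h1]
    exact (hDc.prod hVc).image _ hss.continuousOn
  · intro g z hz
    refine ⟨hSm g (hfix g) hz.1, ?_⟩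
    change (p (c.act g z), l (c.act g z)) ∈ D ×ˢ V
    rw [hpeq g z (hSd hz.1), heq g z (hSd hz.1)]
    exact ⟨hDm g hz.2.1, hVm _ (hfix' _) hz.2.2⟩
  · change (p y, l y) ∈ D ×ˢ V
    rw [hpy]
    exact ⟨hD0, hyV⟩

end OrbifoldChart

/-! ### The local form of submersions. -/

theorem proposition3p2p1 {n m : ℕ}
    {X : Type*} [TopologicalSpace X] {Y : Type*} [TopologicalSpace Y]
    (O : Orbifold (EuclideanSpace ℝ (Fin n)) X) (P : Orbifold (EuclideanSpace ℝ (Fin m)) Y)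
    (f : X → Y) (hf : O.IsSmooth P.toOrbifoldStructure f)
    (x : X) (hx : O.IsSubmersionAt P.toOrbifoldStructure f x) :
    ∃ (k : ℕ) (F : Type) (_ : TopologicalSpace F) (𝓕 : Orbifold (EuclideanSpace ℝ (Fin k)) F)
      -- a chart `(Ṽ, Γ_{f(x)}, φ)` around `f x` and a smooth action of `Γ_{f(x)}` on `𝓕`
      (c : OrbifoldChart (EuclideanSpace ℝ (Fin m)) Y) (_ : MulAction c.grp F)
      -- the quotient orbifolds `(𝓕 × Ṽ) // Γ_{f(x)}` and `Ṽ // Γ_{f(x)}`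
      (Q : Orbifold (EuclideanSpace ℝ (Fin k) × EuclideanSpace ℝ (Fin m))
        (Quotient (MulAction.orbitRel c.grp (F × c.dom))))
      (B : Orbifold (EuclideanSpace ℝ (Fin m)) (Quotient (MulAction.orbitRel c.grp c.dom)))
      (U : Set X) (Θ : X → Quotient (MulAction.orbitRel c.grp (F × c.dom))),
      P.IsChart c ∧ c.IsAround (f x) ∧
      𝓕.IsSmoothAction c.grp ∧
      (𝓕.prod (.ofOpen c.dom c.isOpen_dom c.isConnected_dom)).IsQuotient c.grp
        Q.toOrbifoldStructure ∧
      (OrbifoldStructure.ofOpen c.dom c.isOpen_dom c.isConnected_dom).IsQuotient c.grp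
        B.toOrbifoldStructure ∧
      x ∈ U ∧
      O.IsDiffeoOn Q.toOrbifoldStructure U univ Θ ∧
      B.IsDiffeoOn P.toOrbifoldStructure univ c.image c.orbitMap ∧
      ∀ y ∈ U, f y = c.orbitMap (orbitProj c.grp F c.dom (Θ y)) := by
  
  obtain ⟨L, ⟨y, hy, hyx, hsurj⟩, hhom⟩ := hx
  have hfix : ∀ g, L.src.act g y = y := fun g =>
    L.src_around.unique ⟨L.src.act_mapsTo g hy, by rw [L.src.map_act g y hy, hyx]⟩ ⟨hy, hyx⟩
  have hly := L.lift_mapsTo hy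
  have hlyx : L.tgt.map (L.lift y) = f x := by rw [L.comm y hy, hyx]
  have hfix' : ∀ g, L.tgt.act g (L.lift y) = L.lift y := fun g =>
    L.tgt_around.unique ⟨L.tgt.act_mapsTo g hly, by rw [L.tgt.map_act g _ hly, hlyx]⟩ ⟨hly, hlyx⟩
  obtain ⟨k, a, p, s, D, V, W, ha1, ham, hDo, hDc, hDm, hVo, hVc, hVd, hVm, hyV, hWo, hWc, hWd, hWm,
    hyW, hpW, hsW, hinv, hps, hss, hpeq⟩ := L.src.exists_equivariant_product L.tgt L.hom L.lift
      L.lift_mapsTo L.lift_smooth L.equivariant hy hfix hfix' hsurj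
  -- `W` and `V` are invariant under the full local groups, so both charts shrink without changing
  -- their groups or `L.hom`.
  let b := L.src.restrict W hWo hWc hWd L.src.grp (MonoidHom.id _) Function.injective_id hWm
    (fun g _ _ _ => ⟨g, rfl⟩)
  let c := L.tgt.restrict V hVo hVc hVd L.tgt.grp (MonoidHom.id _) Function.injective_id hVm
    (fun g _ _ _ => ⟨g, rfl⟩)
  refine exists_bundle_of_equivariant_product O P f x b (L.src_isChart.restrict _ _ _ _ _ _ _ _ _)
    ⟨y, hyW, hyx⟩ c (L.tgt_isChart.restrict _ _ _ _ _ _ _ _ _) ⟨L.lift y, ⟨hyV, hlyx⟩, ?_⟩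
    L.hom hhom D hDo hDc (fun g => a g) hDm (fun v _ => ha1 v) (fun g g' v _ => ham g g' v)
    (fun g => (a g).contDiff.contDiffOn) (fun z => (p z, L.lift z)) s hpW hsW
    (hps.prodMk (L.lift_smooth.mono hWd)) hss hinv
    (fun g z hz => Prod.ext (hpeq g z hz) (L.equivariant g z (hWd hz)))
    (fun z hz => L.comm z (hWd hz))
  rintro z ⟨hz, hzx⟩
  exact L.tgt_around.unique ⟨hVd hz, hzx⟩ ⟨hly, hlyx⟩
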